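/- **Conventions.** For a category $\mathbf C$ with finite colimits, $\mathrm{Cospan}(\mathbf C)$ has the objects of $\mathbf C$; its morphisms $A\to B$ are cospans $A\to X\leftarrow B$ up to isomorphism of the apex $X$ commuting with both legs; composition is by pushout, and the coproduct makes it a symmetric monoidal category. $\mathbf{Graph}$ is the category of functors from $\bullet\rightrightarrows\bullet$ to $\mathbf{Set}$, i.e. of graphs $s,t\colon E\rightrightarrows V$, and $\mathrm{Cospan}(\mathbf{Graph})_*$ is the full subcategory of $\mathrm{Cospan}(\mathbf{Graph})$ on the discrete graphs $\emptyset\rightrightarrows V$. A *feedback category* is a symmetric monoidal category with an operator $\mathrm{fbk}_S\colon \mathbf C(S\otimes A,S\otimes B)\to\mathbf C(A,B)$ such that (up to the evident associators and unitors): * $u;\mathrm{fbk}_S(f);v=\mathrm{fbk}_S((\mathrm{id}\otimes u);f;(\mathrm{id}\otimes v))$; * $\mathrm{fbk}_I(f)=f$; * $\mathrm{fbk}_T(\mathrm{fbk}_S(f))=\mathrm{fbk}_{S\otimes T}(f)$; * $\mathrm{fbk}_S(f)\otimes g=\mathrm{fbk}_S(f\otimes g)$; * $\mathrm{fbk}_T(f;(h\otimes\mathrm{id}))=\mathrm{fbk}_S((h\otimes\mathrm{id});f)$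 for every $f\colon T\otimes A\to S\otimes B$ and every isomorphism $h\colon S\to T$. A *feedback functor* is a strong symmetric monoidal functor $F$, with structure isomorphisms $\mu$, such that $F(\mathrm{fbk}_S f)=\mathrm{fbk}_{FS}(\mu;Ff;\mu^{-1})$. For a symmetric monoidal category $\mathbf C$, $\mathrm{St}(\mathbf C)$ has the objects of $\mathbf C$; its morphisms $A\to B$ are pairs $(S\mid f)$ with $S\in\mathbf C$ and $f\colon S\otimes A\to S\otimes B$, where $(S\mid f)=(T\mid (h^{-1}\otimes\mathrm{id});f;(h\otimes\mathrm{id}))$ for every isomorphism $h\colon S\cong T$. The identity of $A$ is $(I\mid\mathrm{id}_{I\otimes A})$, and composition and tensor product are (with $\sigma$ the symmetry) $$(S\mid f);(T\mid g)=(S\otimes T\mid(\sigma\otimes\mathrm{id});(\mathrm{id}\otimes f);(\sigma\otimes\mathrm{id});(\mathrm{id}\otimes g)),$$ $$(S\mid f)\otimes(S'\mid f')=(S\otimes S'\mid(\mathrm{id}\otimes\sigma\otimes\mathrm{id});(f\otimes f');(\mathrm{id}\otimes\sigma\otimes\mathrm{id})).$$ It carries the operator $\mathrm{store}_T(S\mid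 f)=(S\otimes T\mid f)$ and the strong symmetric monoidal functor $J\colon\mathbf C\to\mathrm{St}(\mathbf C)$, $A\mapsto A$, $f\mapsto(I\mid \mathrm{id}_I\otimes f)$. **Statement.** 1. $\mathrm{St}(\mathrm{Cospan}(\mathbf{Set}))$ with the operator $\mathrm{store}$ is the free feedback category over $\mathrm{Cospan}(\mathbf{Set})$: it is a feedback category, and for every feedback category $\mathbf D$ and every strong symmetric monoidal functor $F\colon\mathrm{Cospan}(\mathbf{Set})\to\mathbf D$ there is a unique feedback functor $G\colon \mathrm{St}(\mathrm{Cospan}(\mathbf{Set}))\to\mathbf D$ with $J;G=F$ (as strong symmetric monoidal functors). 2. There is an isomorphism of categories $$K\colon\mathrm{St}(\mathrm{Cospan}(\mathbf{Set}))\;\cong\;\mathrm{Cospan}(\mathbf{Graph})_*,$$ given on objects by $A\mapsto(\emptyset\rightrightarrows A)$ and on morphisms by $$\bigl(E\;\big|\;E+A\xrightarrow{[t\mid a]}V\xleftarrow{[s\mid b]}E+B\bigr)\;\longmapsto\;\bigl((\emptyset\rightrightarrows A)\xrightarrow{\,a\,}(s,t\colon E\rightrightarrows V)\xleftarrow{\,b\,}(\emptyset\rightrightarrows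 B)\bigr).$$ 3. The morphisms of $\mathrm{Cospan}(\mathbf{Graph})_*$ are graphs whose boundary vertices are marked: every morphism $(\emptyset\rightrightarrows X)\to(\emptyset\rightrightarrows Y)$ is given by a graph $G$ with vertex set $V$ and two functions $l\colon X\to V$, $r\colon Y\to V$, and $(G,l,r)$, $(G',l',r')$ give the same morphism if and only if there is an isomorphism of graphs $G\cong G'$ that carries $l$ to $l'$ and $r$ to $r'$. -/

import Mathlib

universe u v u' v' w₁ w₂

namespace FreeFeedback

set_option linter.unusedSectionVars false
set_option linter.unusedSimpArgs false

open CategoryTheory MonoidalCategory Limits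

section Cospans

/-- The category of cospans in `C`: it has the objects of `C`. -/
structure Cospan (C : Type u) where
  /-- the underlying object of `C` -/
  of : C

variable {C : Type u} [Category.{v} C]

/-- A cospan `A ⟶ X ⟵ B`. -/
structure CospanDiagram (A B : C) where
  /-- the apex -/
  apex : C
  /-- the left leg -/
  left : A ⟶ apex
  /-- the right leg -/
  right : B ⟶ apex

/-- Two cospans are equal up to an isomorphism of their apexes that commutes with both legs. -/
def CospanDiagram.Rel {A B : C} (x y : CospanDiagram A B) : Prop :=
  ∃ e : x.apex ≅ y.apex, x.left ≫ e.hom = y.left ∧ x.right ≫ e.hom = y.right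

instance CospanDiagram.setoid (A B : C) : Setoid (CospanDiagram A B) where
  r := CospanDiagram.Rel
  iseqv :=
    { refl := fun x => ⟨Iso.refl _, by simp⟩
      symm := by
        rintro x y ⟨e, h, h'⟩
        exact ⟨e.symm, by simp [← h], by simp [← h']⟩
      trans := by
        rintro x y z ⟨e, h, h'⟩ ⟨k, j, j'⟩
        exact ⟨e ≪≫ k, by simp [← j, ← h], by simp [← j', ← h']⟩ }

/-- Isomorphism classes of cospans. -/
def Cospan.Hom (A B : C) := Quotient (CospanDiagram.setoid A B)

/-- The isomorphism class of a cospan. -/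
def Cospan.Hom.mk {A B X : C} (f : A ⟶ X) (g : B ⟶ X) : Cospan.Hom A B :=
  Quotient.mk _ ⟨X, f, g⟩

namespace Cospan

lemma Hom.sound {A B X Y : C} {f : A ⟶ X} {g : B ⟶ X} {f' : A ⟶ Y} {g' : B ⟶ Y} (e : X ≅ Y)
    (h : f ≫ e.hom = f') (h' : g ≫ e.hom = g') : Hom.mk f g = Hom.mk f' g' :=
  Quotient.sound ⟨e, h, h'⟩

lemma Hom.ind {A B : C} {p : Hom A B → Prop} (h : ∀ X f g, p (Hom.mk (X := X) f g)) (x) : p x :=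
  Quotient.ind (fun a => h a.1 a.2 a.3) x

lemma isPushout_desc_iso {A B D X Y P Q : C} {f : B ⟶ X} {g : B ⟶ Y} {i : X ⟶ P} {j : Y ⟶ P}
    {i' : X ⟶ Q} {j' : Y ⟶ Q} (h : IsPushout f g i j) (h' : IsPushout f g i' j')
    (l : A ⟶ X) (r : D ⟶ Y) : Hom.mk (l ≫ i) (r ≫ j) = Hom.mk (l ≫ i') (r ≫ j') :=
  Hom.sound (h.isoIsPushout _ _ h') (by simp) (by simp)

/-- Composition of cospans, by pushout along the common foot. -/
noncomputable def Hom.comp [HasPushouts C] {A B D : C} : Hom A B → Hom B D → Hom A D :=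
  Quotient.map₂ (fun x y => ⟨pushout x.right y.left, x.left ≫ pushout.inl x.right y.left,
      y.right ≫ pushout.inr x.right y.left⟩) (by
    rintro x x' ⟨e, h, h'⟩ y y' ⟨k, j, j'⟩
    have hp : IsPushout x.right y.left (e.hom ≫ pushout.inl x'.right y'.left)
        (k.hom ≫ pushout.inr x'.right y'.left) :=
      (IsPushout.of_hasPushout x'.right y'.left).of_iso (Iso.refl _) e.symm k.symm (Iso.refl _)
        (by simp [← h']) (by simp [← j]) (by simp) (by simp)
    refine ⟨(IsPushout.of_hasPushout _ _).isoIsPushout _ _ hp, ?_, ?_⟩ <;> simp [← h, ← j'])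

lemma Hom.comp_eq [HasPushouts C] {A B D X Y P : C} {l : A ⟶ X} {f : B ⟶ X} {g : B ⟶ Y}
    {r : D ⟶ Y} {i : X ⟶ P} {j : Y ⟶ P} (h : IsPushout f g i j) :
    Hom.comp (Hom.mk l f) (Hom.mk g r) = Hom.mk (l ≫ i) (r ≫ j) :=
  isPushout_desc_iso (IsPushout.of_hasPushout f g) h l r

/-- The category of cospans. -/
noncomputable instance category [HasPushouts C] : Category (Cospan C) where
  Hom A B := Hom A.of B.of
  id A := Hom.mk (𝟙 A.of) (𝟙 A.of)
  comp f g := Hom.comp f g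
  id_comp f := by
    induction f using Hom.ind with | h X f g
    rw [Hom.comp_eq (IsPushout.of_id_fst)]; simp
  comp_id f := by
    induction f using Hom.ind with | h X f g
    rw [Hom.comp_eq (IsPushout.of_id_snd)]; simp
  assoc f g h := by
    induction f using Hom.ind with | h X f f'
    induction g using Hom.ind with | h Y g g'
    induction h using Hom.ind with | h Z h h'
    have p := IsPushout.of_hasPushout f' g
    have q := IsPushout.of_hasPushout g' h
    have r := IsPushout.of_hasPushout (pushout.inr f' g) (pushout.inl g' h)
    rw [Hom.comp_eq p, Hom.comp_eq q, Hom.comp_eq (q.paste_horiz r),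
      Hom.comp_eq (p.paste_vert r)]
    simp

variable [HasPushouts C]

/-- The morphism of `Cospan C` given by a cospan `A ⟶ X ⟵ B`. -/
def cospan {A B X : C} (f : A ⟶ X) (g : B ⟶ X) : (⟨A⟩ : Cospan C) ⟶ ⟨B⟩ := Hom.mk f g

lemma hom_ind {A B : C} {p : ((⟨A⟩ : Cospan C) ⟶ ⟨B⟩) → Prop}
    (h : ∀ X f g, p (cospan (X := X) f g)) (x) : p x :=
  Hom.ind h x

lemma cospan_eq {A B X Y : C} {f : A ⟶ X} {g : B ⟶ X} {f' : A ⟶ Y} {g' : B ⟶ Y} (e : X ≅ Y)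
    (h : f ≫ e.hom = f') (h' : g ≫ e.hom = g') : cospan f g = cospan f' g' :=
  Hom.sound e h h'

lemma comp_eq {A B D X Y P : C} {l : A ⟶ X} {f : B ⟶ X} {g : B ⟶ Y}
    {r : D ⟶ Y} {i : X ⟶ P} {j : Y ⟶ P} (h : IsPushout f g i j) :
    cospan l f ≫ cospan g r = cospan (l ≫ i) (r ≫ j) := Hom.comp_eq h

lemma id_eq (A : C) : 𝟙 (⟨A⟩ : Cospan C) = cospan (𝟙 A) (𝟙 A) := rfl

/-- The cospan `A ⟶ B ⟵ B` of a morphism `A ⟶ B`. -/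
def lift {A B : C} (f : A ⟶ B) : (⟨A⟩ : Cospan C) ⟶ ⟨B⟩ := cospan f (𝟙 B)

lemma lift_comp_cospan {A B D X : C} (f : A ⟶ B) (g : B ⟶ X) (h : D ⟶ X) :
    lift f ≫ cospan g h = cospan (f ≫ g) h := by
  rw [lift, comp_eq IsPushout.of_id_fst]; simp

lemma cospan_comp_lift_iso {A B D X : C} (g : A ⟶ X) (h : B ⟶ X) (e : B ≅ D) :
    cospan g h ≫ lift e.hom = cospan g (e.inv ≫ h) := by
  have : IsPushout h e.hom (𝟙 X) (e.inv ≫ h) := IsPushout.of_vert_isIso ⟨by simp⟩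
  rw [lift, comp_eq this]; simp

lemma lift_id (A : C) : lift (𝟙 A) = 𝟙 (⟨A⟩ : Cospan C) := rfl

lemma lift_comp {A B D : C} (f : A ⟶ B) (g : B ⟶ D) : lift (f ≫ g) = lift f ≫ lift g := by
  rw [show lift g = cospan _ _ from rfl, lift_comp_cospan, lift]

/-- An isomorphism of `C`, as an isomorphism of cospans. -/
@[simps]
def liftIso {A B : C} (e : A ≅ B) : (⟨A⟩ : Cospan C) ≅ ⟨B⟩ where
  hom := lift e.hom
  inv := lift e.inv
  hom_inv_id := by rw [← lift_comp, e.hom_inv_id, lift_id]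
  inv_hom_id := by rw [← lift_comp, e.inv_hom_id, lift_id]

variable [HasBinaryCoproducts C]

lemma isPushout_coprod {A A' X X' Y Y' P P' : C} {f : A ⟶ X} {g : A ⟶ Y} {i : X ⟶ P} {j : Y ⟶ P}
    {f' : A' ⟶ X'} {g' : A' ⟶ Y'} {i' : X' ⟶ P'} {j' : Y' ⟶ P'} (h : IsPushout f g i j)
    (h' : IsPushout f' g' i' j') :
    IsPushout (coprod.map f f') (coprod.map g g') (coprod.map i i') (coprod.map j j') := by
  refine ⟨⟨by simp [h.w, h'.w]⟩, ⟨PushoutCocone.IsColimit.mk _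
    (fun s => coprod.desc
      (h.desc (coprod.inl ≫ s.inl) (coprod.inl ≫ s.inr)
        (by simpa using coprod.inl ≫= s.condition))
      (h'.desc (coprod.inr ≫ s.inl) (coprod.inr ≫ s.inr)
        (by simpa using coprod.inr ≫= s.condition))) ?_ ?_ ?_⟩⟩
  · intro s
    rw [coprod.map_desc, h.inl_desc, h'.inl_desc]
    ext
    · exact coprod.inl_desc _ _
    · exact coprod.inr_desc _ _
  · intro s
    rw [coprod.map_desc, h.inr_desc, h'.inr_desc]
    ext
    · exact coprod.inl_desc _ _
    · exact coprod.inr_desc _ _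
  · intro s m h1 h2
    apply coprod.hom_ext
    · refine Eq.trans ?_ (coprod.inl_desc _ _).symm
      apply h.hom_ext <;> simp [← h1, ← h2]
    · refine Eq.trans ?_ (coprod.inr_desc _ _).symm
      apply h'.hom_ext <;> simp [← h1, ← h2]

/-- The coproduct of two cospans. -/
noncomputable def Hom.tensor {A B A' B' : C} :
    Hom A B → Hom A' B' → Hom (A ⨿ A') (B ⨿ B') :=
  Quotient.map₂ (fun x y => ⟨x.apex ⨿ y.apex, coprod.map x.left y.left,
      coprod.map x.right y.right⟩) (by
    rintro x x' ⟨e, h, h'⟩ y y' ⟨k, j, j'⟩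
    exact ⟨coprod.mapIso e k, by simp [← h, ← j], by simp [← h', ← j']⟩)

/-- The coproduct of two cospans. -/
noncomputable def tensor {A B A' B' : Cospan C} (f : A ⟶ B) (f' : A' ⟶ B') :
    (⟨A.of ⨿ A'.of⟩ : Cospan C) ⟶ ⟨B.of ⨿ B'.of⟩ := Hom.tensor f f'

lemma tensor_cospan {A B X A' B' X' : C} (f : A ⟶ X) (g : B ⟶ X) (f' : A' ⟶ X') (g' : B' ⟶ X') :
    tensor (cospan f g) (cospan f' g') = cospan (coprod.map f f') (coprod.map g g') := rfl

lemma tensor_id (A B : Cospan C) : tensor (𝟙 A) (𝟙 B) = 𝟙 (⟨A.of ⨿ B.of⟩ : Cospan C) := by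
  rw [id_eq, id_eq, tensor_cospan, id_eq]; simp

lemma tensor_lift {A B A' B' : C} (f : A ⟶ B) (f' : A' ⟶ B') :
    tensor (lift f) (lift f') = lift (coprod.map f f') := by
  rw [lift, lift, tensor_cospan, lift]; simp

lemma tensor_lift_id {A B X : C} (f : A ⟶ B) :
    tensor (lift f) (𝟙 (⟨X⟩ : Cospan C)) = lift (coprod.map f (𝟙 X)) := tensor_lift f (𝟙 X)

lemma tensor_id_lift {A B X : C} (f : A ⟶ B) :
    tensor (𝟙 (⟨X⟩ : Cospan C)) (lift f) = lift (coprod.map (𝟙 X) f) := tensor_lift (𝟙 X) f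

lemma tensor_comp {A B D A' B' D' : Cospan C} (f : A ⟶ B) (f' : A' ⟶ B') (g : B ⟶ D)
    (g' : B' ⟶ D') : tensor f f' ≫ tensor g g' = tensor (f ≫ g) (f' ≫ g') := by
  induction f using hom_ind with | h X f₁ f₂
  induction g using hom_ind with | h Y g₁ g₂
  induction f' using hom_ind with | h X' f₁' f₂'
  induction g' using hom_ind with | h Y' g₁' g₂'
  have p := IsPushout.of_hasPushout f₂ g₁
  have q := IsPushout.of_hasPushout f₂' g₁'
  rw [tensor_cospan, tensor_cospan, comp_eq p, comp_eq q, tensor_cospan,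
    comp_eq (isPushout_coprod p q)]
  simp

variable [HasInitial C]

noncomputable instance monoidalStruct : MonoidalCategoryStruct (Cospan C) where
  tensorObj A B := ⟨A.of ⨿ B.of⟩
  tensorHom f g := tensor f g
  whiskerLeft A _ _ f := tensor (𝟙 A) f
  whiskerRight f A := tensor f (𝟙 A)
  tensorUnit := ⟨⊥_ C⟩
  associator A B D := liftIso (coprod.associator A.of B.of D.of)
  leftUnitor A := liftIso (coprod.leftUnitor A.of)
  rightUnitor A := liftIso (coprod.rightUnitor A.of)

/-- The monoidal category of cospans, with tensor product the coproduct. -/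
noncomputable instance monoidal : MonoidalCategory (Cospan C) := MonoidalCategory.ofTensorHom
  (id_tensorHom_id := tensor_id)
  (id_tensorHom := fun _ _ _ _ => rfl)
  (tensorHom_id := fun _ _ => rfl)
  (tensorHom_comp_tensorHom := tensor_comp)
  (associator_naturality := by
    intro ⟨A⟩ ⟨A'⟩ ⟨A''⟩ ⟨B⟩ ⟨B'⟩ ⟨B''⟩ f f' f''
    induction f using hom_ind with | h X f g
    induction f' using hom_ind with | h X' f' g'
    induction f'' using hom_ind with | h X'' f'' g''
    change tensor (tensor (cospan f g) (cospan f' g')) (cospan f'' g'') ≫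
      lift (coprod.associator B B' B'').hom = lift (coprod.associator A A' A'').hom ≫
        tensor (cospan f g) (tensor (cospan f' g') (cospan f'' g''))
    rw [tensor_cospan, tensor_cospan, tensor_cospan, tensor_cospan, cospan_comp_lift_iso,
      lift_comp_cospan]
    refine cospan_eq (coprod.associator X X' X'') (coprod.associator_naturality ..) ?_
    rw [Category.assoc, coprod.associator_naturality, Iso.inv_hom_id_assoc])
  (leftUnitor_naturality := by
    intro ⟨A⟩ ⟨B⟩ f
    induction f using hom_ind with | h X f g
    change tensor (cospan (𝟙 (⊥_ C)) (𝟙 (⊥_ C))) (cospan f g) ≫ lift (coprod.leftUnitor B).hom =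
      lift (coprod.leftUnitor A).hom ≫ cospan f g
    rw [tensor_cospan, cospan_comp_lift_iso, lift_comp_cospan]
    refine cospan_eq (coprod.leftUnitor X) (coprod.leftUnitor_naturality f) ?_
    rw [Category.assoc, coprod.leftUnitor_naturality, Iso.inv_hom_id_assoc])
  (rightUnitor_naturality := by
    intro ⟨A⟩ ⟨B⟩ f
    induction f using hom_ind with | h X f g
    change tensor (cospan f g) (cospan (𝟙 (⊥_ C)) (𝟙 (⊥_ C))) ≫ lift (coprod.rightUnitor B).hom =
      lift (coprod.rightUnitor A).hom ≫ cospan f g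
    rw [tensor_cospan, cospan_comp_lift_iso, lift_comp_cospan]
    refine cospan_eq (coprod.rightUnitor X) (coprod.rightUnitor_naturality f) ?_
    rw [Category.assoc, coprod.rightUnitor_naturality, Iso.inv_hom_id_assoc])
  (pentagon := by
    intro ⟨W⟩ ⟨X⟩ ⟨Y⟩ ⟨Z⟩
    change tensor (lift (coprod.associator W X Y).hom) (𝟙 _) ≫
        lift (coprod.associator W (X ⨿ Y) Z).hom ≫
          tensor (𝟙 _) (lift (coprod.associator X Y Z).hom) =
      lift (coprod.associator (W ⨿ X) Y Z).hom ≫ lift (coprod.associator W X (Y ⨿ Z)).hom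
    rw [tensor_lift_id, tensor_id_lift, ← lift_comp, ← lift_comp, ← lift_comp, coprod.pentagon])
  (triangle := by
    intro ⟨X⟩ ⟨Y⟩
    change lift (coprod.associator X (⊥_ C) Y).hom ≫
        tensor (𝟙 _) (lift (coprod.leftUnitor Y).hom) =
      tensor (lift (coprod.rightUnitor X).hom) (𝟙 _)
    rw [tensor_lift_id, tensor_id_lift, ← lift_comp, coprod.triangle])

/-- The symmetry of the monoidal category of cospans is that of the coproduct. -/
noncomputable instance symmetric : SymmetricCategory (Cospan C) where
  braiding A B := liftIso (coprod.braiding A.of B.of)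
  braiding_naturality_right := by
    intro ⟨X⟩ ⟨A⟩ ⟨B⟩ f
    induction f using hom_ind with | h Y f g
    change tensor (cospan (𝟙 X) (𝟙 X)) (cospan f g) ≫ lift (coprod.braiding X B).hom =
      lift (coprod.braiding X A).hom ≫ tensor (cospan f g) (cospan (𝟙 X) (𝟙 X))
    rw [tensor_cospan, tensor_cospan, cospan_comp_lift_iso, lift_comp_cospan]
    refine cospan_eq (coprod.braiding X Y) ?_ ?_ <;> ext <;>
      simp [coprod.inl_desc, coprod.inr_desc, coprod.inl_desc_assoc, coprod.inr_desc_assoc]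
  braiding_naturality_left := by
    intro ⟨A⟩ ⟨B⟩ f ⟨X⟩
    induction f using hom_ind with | h Y f g
    change tensor (cospan f g) (cospan (𝟙 X) (𝟙 X)) ≫ lift (coprod.braiding B X).hom =
      lift (coprod.braiding A X).hom ≫ tensor (cospan (𝟙 X) (𝟙 X)) (cospan f g)
    rw [tensor_cospan, tensor_cospan, cospan_comp_lift_iso, lift_comp_cospan]
    refine cospan_eq (coprod.braiding Y X) ?_ ?_ <;> ext <;>
      simp [coprod.inl_desc, coprod.inr_desc, coprod.inl_desc_assoc, coprod.inr_desc_assoc]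
  hexagon_forward := by
    intro ⟨X⟩ ⟨Y⟩ ⟨Z⟩
    change lift (coprod.associator X Y Z).hom ≫ lift (coprod.braiding X (Y ⨿ Z)).hom ≫
        lift (coprod.associator Y Z X).hom =
      tensor (lift (coprod.braiding X Y).hom) (𝟙 _) ≫ lift (coprod.associator Y X Z).hom ≫
        tensor (𝟙 _) (lift (coprod.braiding X Z).hom)
    rw [tensor_lift_id, tensor_id_lift]
    simp only [← lift_comp]
    congr 1
    ext <;> simp [coprod.inl_desc, coprod.inr_desc, coprod.inl_desc_assoc, coprod.inr_desc_assoc]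
  hexagon_reverse := by
    intro ⟨X⟩ ⟨Y⟩ ⟨Z⟩
    change lift (coprod.associator X Y Z).inv ≫ lift (coprod.braiding (X ⨿ Y) Z).hom ≫
        lift (coprod.associator Z X Y).inv =
      tensor (𝟙 _) (lift (coprod.braiding Y Z).hom) ≫ lift (coprod.associator X Z Y).inv ≫
        tensor (lift (coprod.braiding X Z).hom) (𝟙 _)
    rw [tensor_lift_id, tensor_id_lift]
    simp only [← lift_comp]
    congr 1
    ext <;> simp [coprod.inl_desc, coprod.inr_desc, coprod.inl_desc_assoc, coprod.inr_desc_assoc]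
  symmetry := by
    intro ⟨X⟩ ⟨Y⟩
    change lift (coprod.braiding X Y).hom ≫ lift (coprod.braiding Y X).hom = 𝟙 _
    rw [← lift_comp, coprod.symmetry, lift_id]

end Cospan
end Cospans

section Feedback

variable (C : Type u) [Category.{v} C] [MonoidalCategory C]

/-- The type of operators `fbk_S : C(S ⊗ A, S ⊗ B) → C(A, B)`. -/
abbrev FeedbackOperator : Type max u v := ∀ S A B : C, (S ⊗ A ⟶ S ⊗ B) → (A ⟶ B)

variable {C} [SymmetricCategory C]

/-- The axioms of a feedback category, for an operator on a symmetric monoidal category. -/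
structure FeedbackOperator.IsFeedback (fbk : FeedbackOperator C) : Prop where
  tightening {S A A' B B' : C} (u : A' ⟶ A) (f : S ⊗ A ⟶ S ⊗ B) (v : B ⟶ B') :
    u ≫ fbk S A B f ≫ v = fbk S A' B' (S ◁ u ≫ f ≫ S ◁ v)
  vanishing {A B : C} (f : A ⟶ B) : fbk (𝟙_ C) A B ((λ_ A).hom ≫ f ≫ (λ_ B).inv) = f
  joining {S T A B : C} (f : S ⊗ (T ⊗ A) ⟶ S ⊗ (T ⊗ B)) :
    fbk T A B (fbk S (T ⊗ A) (T ⊗ B) f) =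
      fbk (S ⊗ T) A B ((α_ S T A).hom ≫ f ≫ (α_ S T B).inv)
  strength {S A B A' B' : C} (f : S ⊗ A ⟶ S ⊗ B) (g : A' ⟶ B') :
    fbk S A B f ⊗ₘ g =
      fbk S (A ⊗ A') (B ⊗ B') ((α_ S A A').inv ≫ (f ⊗ₘ g) ≫ (α_ S B B').hom)
  sliding {S T A B : C} (f : T ⊗ A ⟶ S ⊗ B) (h : S ≅ T) :
    fbk T A B (f ≫ h.hom ▷ B) = fbk S A B (h.hom ▷ A ≫ f)

end Feedback

section Functors

/-- A strong symmetric monoidal functor. -/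
structure SymmetricMonoidalFunctor (C : Type u) [Category.{v} C] [MonoidalCategory C]
    [SymmetricCategory C] (D : Type u') [Category.{v'} D] [MonoidalCategory D]
    [SymmetricCategory D] where
  /-- the underlying functor -/
  functor : C ⥤ D
  /-- the structure of a strong symmetric monoidal functor -/
  [braided : functor.Braided]

attribute [instance] SymmetricMonoidalFunctor.braided

variable {C : Type u} [Category.{v} C] [MonoidalCategory C] [SymmetricCategory C]
  {D : Type u'} [Category.{v'} D] [MonoidalCategory D] [SymmetricCategory D]

/-- Composition of strong symmetric monoidal functors. -/
def SymmetricMonoidalFunctor.comp {E : Type*} [Category E] [MonoidalCategory E]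
    [SymmetricCategory E] (F : SymmetricMonoidalFunctor C D) (G : SymmetricMonoidalFunctor D E) :
    SymmetricMonoidalFunctor C E where
  functor := F.functor ⋙ G.functor

/-- A strong symmetric monoidal functor is a feedback functor when
`F (fbk_S f) = fbk_{F S} (μ ≫ F f ≫ μ⁻¹)`. -/
def SymmetricMonoidalFunctor.PreservesFeedback (F : SymmetricMonoidalFunctor C D)
    (fbkC : FeedbackOperator C) (fbkD : FeedbackOperator D) : Prop :=
  ∀ (S A B : C) (f : S ⊗ A ⟶ S ⊗ B),
    F.functor.map (fbkC S A B f) = fbkD (F.functor.obj S) (F.functor.obj A) (F.functor.obj B)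
      (Functor.LaxMonoidal.μ F.functor S A ≫ F.functor.map f ≫
        Functor.OplaxMonoidal.δ F.functor S B)

/-- `D`, with the operator `fbk` and the strong symmetric monoidal functor `J : C ⟶ D`, is the free
feedback category over the symmetric monoidal category `C`: every strong symmetric monoidal functor
from `C` to a feedback category extends along `J` to a unique feedback functor. -/
def IsFreeFeedbackCategory (fbk : FeedbackOperator D)
    (J : SymmetricMonoidalFunctor C D) : Prop :=
  fbk.IsFeedback ∧
    ∀ (E : Type w₂) [Category.{w₁} E] [MonoidalCategory E] [SymmetricCategory E]
      (fbkE : FeedbackOperator E), fbkE.IsFeedback → ∀ F : SymmetricMonoidalFunctor C E,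
        ∃! G : SymmetricMonoidalFunctor D E, G.PreservesFeedback fbk fbkE ∧ J.comp G = F

end Functors

section Swap
variable {C : Type u} [Category.{v} C] [MonoidalCategory C] [SymmetricCategory C]

/-- The symmetry `S ⊗ (T ⊗ A) ⟶ T ⊗ (S ⊗ A)`. -/
def swap (S T A : C) : S ⊗ (T ⊗ A) ⟶ T ⊗ (S ⊗ A) :=
  (α_ S T A).inv ≫ (β_ S T).hom ▷ A ≫ (α_ T S A).hom

@[simp]
lemma swap_swap (S T A : C) : swap S T A ≫ swap T S A = 𝟙 _ := by
  simp only [swap, Category.assoc, Iso.hom_inv_id_assoc]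
  rw [← comp_whiskerRight_assoc, SymmetricCategory.symmetry]
  simp

@[simp]
lemma swap_swap_assoc (S T A : C) {Z : C} (k : S ⊗ (T ⊗ A) ⟶ Z) :
    swap S T A ≫ swap T S A ≫ k = k := by
  rw [← Category.assoc, swap_swap, Category.id_comp]

lemma swap_nat₁ {S S' : C} (h : S ⟶ S') (T A : C) :
    h ▷ (T ⊗ A) ≫ swap S' T A = swap S T A ≫ T ◁ (h ▷ A) := by
  simp only [swap, whiskerRight_tensor, Category.assoc, Iso.hom_inv_id_assoc]
  rw [← comp_whiskerRight_assoc, BraidedCategory.braiding_naturality_left]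
  simp

lemma swap_nat₁_assoc {S S' : C} (h : S ⟶ S') (T A : C) {Z : C} (k : T ⊗ (S' ⊗ A) ⟶ Z) :
    h ▷ (T ⊗ A) ≫ swap S' T A ≫ k = swap S T A ≫ T ◁ (h ▷ A) ≫ k := by
  rw [← Category.assoc, swap_nat₁, Category.assoc]

lemma swap_nat₂ {T T' : C} (S : C) (h : T ⟶ T') (A : C) :
    S ◁ (h ▷ A) ≫ swap S T' A = swap S T A ≫ h ▷ (S ⊗ A) := by
  simp only [swap, whiskerRight_tensor, Category.assoc]
  rw [Iso.hom_inv_id_assoc, associator_inv_naturality_middle_assoc, ← comp_whiskerRight_assoc,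
    BraidedCategory.braiding_naturality_right]
  simp

lemma swap_nat₂_assoc {T T' : C} (S : C) (h : T ⟶ T') (A : C) {Z : C}
    (k : T' ⊗ (S ⊗ A) ⟶ Z) :
    S ◁ (h ▷ A) ≫ swap S T' A ≫ k = swap S T A ≫ h ▷ (S ⊗ A) ≫ k := by
  rw [← Category.assoc, swap_nat₂, Category.assoc]

lemma swap_nat₃ {A A' : C} (S T : C) (f : A ⟶ A') :
    S ◁ (T ◁ f) ≫ swap S T A' = swap S T A ≫ T ◁ (S ◁ f) := by
  simp only [swap, Category.assoc]
  rw [associator_inv_naturality_right_assoc, whisker_exchange_assoc]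
  simp

lemma swap_nat₃_assoc {A A' : C} (S T : C) (f : A ⟶ A') {Z : C} (k : T ⊗ (S ⊗ A') ⟶ Z) :
    S ◁ (T ◁ f) ≫ swap S T A' ≫ k = swap S T A ≫ T ◁ (S ◁ f) ≫ k := by
  rw [← Category.assoc, swap_nat₃, Category.assoc]

lemma swap_tensor₁ (S T R A : C) :
    swap (S ⊗ T) R A = (α_ S T (R ⊗ A)).hom ≫ S ◁ swap T R A ≫ swap S R (T ⊗ A) ≫
      R ◁ (α_ S T A).inv := by
  simp only [swap, BraidedCategory.braiding_tensor_left_hom]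
  monoidal

lemma swap_tensor₂ (S T R A : C) :
    swap S (T ⊗ R) A = S ◁ (α_ T R A).hom ≫ swap S T (R ⊗ A) ≫ T ◁ swap S R A ≫
      (α_ T R (S ⊗ A)).inv := by
  simp only [swap, BraidedCategory.braiding_tensor_right_hom]
  monoidal

lemma swap_tensor₃ (S T A B : C) :
    swap S T (A ⊗ B) = S ◁ (α_ T A B).inv ≫ (α_ S (T ⊗ A) B).inv ≫ swap S T A ▷ B ≫
      (α_ T (S ⊗ A) B).hom ≫ T ◁ (α_ S A B).hom := by
  simp only [swap]
  monoidal

lemma swap_unit₁ (T A : C) : swap (𝟙_ C) T A = (λ_ (T ⊗ A)).hom ≫ T ◁ (λ_ A).inv := by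
  simp only [swap, braiding_tensorUnit_left]
  monoidal

lemma swap_unit₂ (S A : C) : swap S (𝟙_ C) A = S ◁ (λ_ A).hom ≫ (λ_ (S ⊗ A)).inv := by
  simp only [swap, braiding_tensorUnit_right]
  monoidal

/-- A morphism `S ⊗ A ⟶ S ⊗ B` run in parallel with an object `T` placed between `S` and `A`. -/
def thru (T : C) {S A B : C} (f : S ⊗ A ⟶ S ⊗ B) : S ⊗ (T ⊗ A) ⟶ S ⊗ (T ⊗ B) :=
  swap S T A ≫ T ◁ f ≫ swap T S B

lemma thru_nat {T T' S A B : C} (u : T ⟶ T') (f : S ⊗ A ⟶ S ⊗ B) :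
    thru T f ≫ S ◁ (u ▷ B) = S ◁ (u ▷ A) ≫ thru T' f := by
  simp only [thru, Category.assoc]
  rw [swap_nat₂_assoc, ← whisker_exchange_assoc, swap_nat₁]

lemma thru_conj {T S S' A B : C} (f : S ⊗ A ⟶ S ⊗ B) (f' : S' ⊗ A ⟶ S' ⊗ B) (h : S ⟶ S')
    (w : f ≫ h ▷ B = h ▷ A ≫ f') :
    thru T f ≫ h ▷ (T ⊗ B) = h ▷ (T ⊗ A) ≫ thru T f' := by
  simp only [thru, Category.assoc]
  rw [swap_nat₁_assoc, ← whiskerLeft_comp_assoc, ← w, whiskerLeft_comp_assoc, swap_nat₂]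

lemma thru_conj_assoc {T S S' A B : C} (f : S ⊗ A ⟶ S ⊗ B) (f' : S' ⊗ A ⟶ S' ⊗ B) (h : S ⟶ S')
    (w : f ≫ h ▷ B = h ▷ A ≫ f') {Z : C} (k : S' ⊗ (T ⊗ B) ⟶ Z) :
    thru T f ≫ h ▷ (T ⊗ B) ≫ k = h ▷ (T ⊗ A) ≫ thru T f' ≫ k := by
  rw [← Category.assoc, thru_conj f f' h w, Category.assoc]

lemma thru_comp {T S A B D : C} (f : S ⊗ A ⟶ S ⊗ B) (g : S ⊗ B ⟶ S ⊗ D) :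
    thru T (f ≫ g) = thru T f ≫ thru T g := by
  simp [thru]

lemma thru_left {T S A B : C} (f : A ⟶ B) :
    thru T (S ◁ f) = S ◁ (T ◁ f) := by
  simp only [thru]
  rw [← swap_nat₃_assoc, swap_swap, Category.comp_id]

lemma thru_tensor {T R S A B : C} (f : S ⊗ A ⟶ S ⊗ B) :
    thru (T ⊗ R) f = S ◁ (α_ T R A).hom ≫ thru T (thru R f) ≫ S ◁ (α_ T R B).inv := by
  have h : swap (T ⊗ R) S B = (α_ T R (S ⊗ B)).hom ≫ T ◁ swap R S B ≫ swap T S (R ⊗ B) ≫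
      S ◁ (α_ T R B).inv := swap_tensor₁ ..
  simp only [thru, h, swap_tensor₂]
  simp

lemma thru_unit {S A B : C} (f : S ⊗ A ⟶ S ⊗ B) :
    thru (𝟙_ C) f = S ◁ (λ_ A).hom ≫ f ≫ S ◁ (λ_ B).inv := by
  simp only [thru, swap_unit₁, swap_unit₂]
  simp

lemma thru_swap {T R S A B : C} (f : S ⊗ A ⟶ S ⊗ B) :
    thru T (thru R f) = S ◁ swap T R A ≫ thru R (thru T f) ≫ S ◁ swap R T B := by
  have h := thru_nat (β_ T R).hom f
  rw [thru_tensor, thru_tensor] at h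
  have h2 := S ◁ (α_ T R A).inv ≫= h =≫ S ◁ (α_ R T B).hom
  simp only [Category.assoc, whiskerLeft_inv_hom_assoc, whiskerLeft_inv_hom, Category.comp_id] at h2
  have h3 := h2 =≫ S ◁ swap R T B
  simp only [Category.assoc] at h3
  rw [← whiskerLeft_comp, ← whiskerLeft_comp, ← whiskerLeft_comp] at h3
  have h4 : (α_ T R B).inv ≫ (β_ T R).hom ▷ B ≫ (α_ R T B).hom ≫ swap R T B = 𝟙 _ := by
    have := swap_swap T R B
    rw [swap] at this; simpa using this
  rw [h4] at h3
  rw [whiskerLeft_id, Category.comp_id] at h3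
  rw [h3]
  simp [swap]

end Swap

section Stateful

/-- The category of stateful processes: it has the objects of `C`. -/
structure St (C : Type u) where
  /-- the underlying object of `C` -/
  of : C

variable {C : Type u} [Category.{v} C] [MonoidalCategory C] [SymmetricCategory C]

/-- A representative `(S ∣ f)` of a stateful process `A ⟶ B`. -/
structure StatefulMap (A B : C) where
  /-- the state space -/
  state : C
  /-- the process, acting on the state space and the input -/
  act : state ⊗ A ⟶ state ⊗ B

/-- Two representatives are equal up to an isomorphism of their state spaces. -/
def StatefulMap.Rel {A B : C} (x y : StatefulMap A B) : Prop :=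
  ∃ h : x.state ≅ y.state, y.act = h.inv ▷ A ≫ x.act ≫ h.hom ▷ B

lemma StatefulMap.rel_iff {A B : C} (x y : StatefulMap A B) :
    x.Rel y ↔ ∃ h : x.state ≅ y.state, x.act ≫ h.hom ▷ B = h.hom ▷ A ≫ y.act := by
  refine exists_congr fun h => ⟨fun e => by simp [e], fun e => by simp [e]⟩

instance StatefulMap.setoid (A B : C) : Setoid (StatefulMap A B) where
  r := StatefulMap.Rel
  iseqv :=
    { refl := fun x => ⟨Iso.refl _, by simp⟩
      symm := by
        rintro x y ⟨h, e⟩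
        exact ⟨h.symm, by simp [e]⟩
      trans := by
        rintro x y z ⟨h, e⟩ ⟨h', e'⟩
        exact ⟨h ≪≫ h', by simp [e, e']⟩ }

/-- The stateful processes `A ⟶ B`, up to isomorphism of the state space. -/
def St.Hom (A B : C) := Quotient (StatefulMap.setoid A B)

/-- The stateful process `(S ∣ f)`. -/
def St.Hom.mk {A B : C} (S : C) (f : S ⊗ A ⟶ S ⊗ B) : St.Hom A B :=
  Quotient.mk _ ⟨S, f⟩

lemma St.Hom.sound {A B S T : C} {f : S ⊗ A ⟶ S ⊗ B} {g : T ⊗ A ⟶ T ⊗ B} (h : S ≅ T)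
    (w : f ≫ h.hom ▷ B = h.hom ▷ A ≫ g) : St.Hom.mk S f = St.Hom.mk T g :=
  Quotient.sound ((StatefulMap.rel_iff ⟨S, f⟩ ⟨T, g⟩).2 ⟨h, w⟩)

lemma St.Hom.ind {A B : C} {p : St.Hom A B → Prop} (h : ∀ S f, p (St.Hom.mk S f)) (x) : p x :=
  Quotient.ind (fun a => h a.1 a.2) x

/-- Sequential composition of representatives: `f` acts on `S`, then `g` acts on `T`. -/
def seqAct {A B D S T : C} (f : S ⊗ A ⟶ S ⊗ B) (g : T ⊗ B ⟶ T ⊗ D) :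
    (S ⊗ T) ⊗ A ⟶ (S ⊗ T) ⊗ D :=
  (α_ S T A).hom ≫ swap S T A ≫ T ◁ f ≫ swap T S B ≫ S ◁ g ≫ (α_ S T D).inv

/-- Parallel composition of representatives. -/
def parAct {A B A' B' S S' : C} (f : S ⊗ A ⟶ S ⊗ B) (f' : S' ⊗ A' ⟶ S' ⊗ B') :
    (S ⊗ S') ⊗ (A ⊗ A') ⟶ (S ⊗ S') ⊗ (B ⊗ B') :=
  tensorμ S S' A A' ≫ (f ⊗ₘ f') ≫ tensorμ S B S' B'

lemma seqAct_eq {A B D S T : C} (f : S ⊗ A ⟶ S ⊗ B) (g : T ⊗ B ⟶ T ⊗ D) :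
    seqAct f g = (α_ S T A).hom ≫ thru T f ≫ S ◁ g ≫ (α_ S T D).inv := by
  simp [seqAct, thru]

lemma seqAct_conj {A B D S T S' T' : C} {f : S ⊗ A ⟶ S ⊗ B} {g : T ⊗ B ⟶ T ⊗ D}
    {f' : S' ⊗ A ⟶ S' ⊗ B} {g' : T' ⊗ B ⟶ T' ⊗ D} (h : S ⟶ S') (k : T ⟶ T')
    (wf : f ≫ h ▷ B = h ▷ A ≫ f') (wg : g ≫ k ▷ D = k ▷ B ≫ g') :
    seqAct f g ≫ (h ⊗ₘ k) ▷ D = (h ⊗ₘ k) ▷ A ≫ seqAct f' g' := by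
  have e1 : (h ⊗ₘ k) ▷ A ≫ (α_ S' T' A).hom =
      (α_ S T A).hom ≫ S ◁ (k ▷ A) ≫ h ▷ (T' ⊗ A) := by
    simp [MonoidalCategory.tensorHom_def']
  have e2 : (α_ S T D).inv ≫ (h ⊗ₘ k) ▷ D =
      h ▷ (T ⊗ D) ≫ S' ◁ (k ▷ D) ≫ (α_ S' T' D).inv := by
    rw [MonoidalCategory.tensorHom_def, comp_whiskerRight]
    simp
  rw [seqAct_eq, seqAct_eq, reassoc_of% e1]
  simp only [Category.assoc]
  rw [e2, whisker_exchange_assoc, ← whiskerLeft_comp_assoc, wg, whiskerLeft_comp_assoc,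
    ← thru_conj_assoc f f' h wf]
  rw [← whisker_exchange_assoc, ← reassoc_of% (thru_nat k f)]


/-- A morphism `S ⊗ A ⟶ S ⊗ B` run in parallel with an object `X` placed last. -/
def wr (X : C) {S A B : C} (f : S ⊗ A ⟶ S ⊗ B) : S ⊗ (A ⊗ X) ⟶ S ⊗ (B ⊗ X) :=
  (α_ S A X).inv ≫ f ▷ X ≫ (α_ S B X).hom

lemma swap_braiding (S T A : C) :
    swap S T A ≫ (β_ T (S ⊗ A)).hom = S ◁ (β_ T A).hom ≫ (α_ S A T).inv := by
  simp only [swap, BraidedCategory.braiding_tensor_right_hom, Category.assoc,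
    Iso.hom_inv_id_assoc]
  rw [← comp_whiskerRight_assoc, SymmetricCategory.symmetry]
  simp

lemma thru_eq_wr (T : C) {S A B : C} (f : S ⊗ A ⟶ S ⊗ B) :
    thru T f = S ◁ (β_ T A).hom ≫ wr T f ≫ S ◁ (β_ B T).hom := by
  have e : swap T S B = (β_ T (S ⊗ B)).hom ≫ (α_ S B T).hom ≫ S ◁ (β_ B T).hom := by
    have := swap_braiding S T B
    have h := swap T S B ≫= this
    rw [swap_swap_assoc] at h
    rw [h]
    simp only [Category.assoc, Iso.inv_hom_id_assoc]
    rw [← whiskerLeft_comp, SymmetricCategory.symmetry]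
    simp
  rw [thru, e, BraidedCategory.braiding_naturality_right_assoc,
    reassoc_of% (swap_braiding S T A), wr]
  simp only [Category.assoc]

lemma wr_tensor (T X : C) {S A B : C} (f : S ⊗ A ⟶ S ⊗ B) :
    wr (T ⊗ X) f = S ◁ (α_ A T X).inv ≫ wr X (wr T f) ≫ S ◁ (α_ B T X).hom := by
  simp only [wr]
  monoidal

lemma thru_wr_aux (T X : C) {S A B : C} (f : S ⊗ A ⟶ S ⊗ B) :
    thru T (wr X f) = S ◁ (α_ T A X).inv ≫ wr X (thru T f) ≫ S ◁ (α_ T B X).hom := by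
  simp only [thru, wr, swap_tensor₃]
  monoidal

lemma wr_comp (X : C) {S A B D : C} (f : S ⊗ A ⟶ S ⊗ B) (g : S ⊗ B ⟶ S ⊗ D) :
    wr X (f ≫ g) = wr X f ≫ wr X g := by
  simp [wr]

lemma wr_left (X : C) {S A B : C} (f : A ⟶ B) : wr X (S ◁ f) = S ◁ (f ▷ X) := by
  simp [wr]

lemma thru_wr (T X : C) {S A B : C} (f : S ⊗ A ⟶ S ⊗ B) :
    thru T (wr X f) = S ◁ swap T A X ≫ wr (T ⊗ X) f ≫ S ◁ swap B T X := by
  rw [thru_wr_aux, thru_eq_wr, wr_comp, wr_comp, wr_left, wr_left, wr_tensor, swap, swap]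
  simp

lemma wr_conj {T S S' A B : C} (f : S ⊗ A ⟶ S ⊗ B) (f' : S' ⊗ A ⟶ S' ⊗ B) (h : S ⟶ S')
    (w : f ≫ h ▷ B = h ▷ A ≫ f') :
    wr T f ≫ h ▷ (B ⊗ T) = h ▷ (A ⊗ T) ≫ wr T f' := by
  simp only [wr, Category.assoc, whiskerRight_tensor, Iso.hom_inv_id_assoc]
  rw [← comp_whiskerRight_assoc, w]
  simp

lemma tensorμ_eq (S S' A A' : C) :
    tensorμ S S' A A' = (α_ S S' (A ⊗ A')).hom ≫ S ◁ swap S' A A' ≫ (α_ S A (S' ⊗ A')).inv := by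
  simp [tensorμ, swap]

lemma parAct_eq {A B A' B' S S' : C} (f : S ⊗ A ⟶ S ⊗ B) (f' : S' ⊗ A' ⟶ S' ⊗ B') :
    parAct f f' = seqAct (wr A' f) (thru B f') := by
  rw [seqAct_eq, thru_wr, thru, parAct, tensorμ_eq, tensorμ_eq, MonoidalCategory.tensorHom_def, wr]
  simp only [whiskerLeft_comp, Category.assoc]
  rw [← whiskerLeft_comp_assoc S (swap B S' A'), swap_swap]
  simp

lemma thru_seqAct (T : C) {A B D S R : C} (f : S ⊗ A ⟶ S ⊗ B) (g : R ⊗ B ⟶ R ⊗ D) :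
    thru T (seqAct f g) = seqAct (thru T f) (thru T g) := by
  have e1 := swap_tensor₁ S R T A
  have e2 := swap_tensor₂ T S R D
  rw [seqAct_eq, seqAct_eq, thru_swap, thru, e1, e2]
  simp only [thru, Category.assoc, whiskerLeft_comp, whiskerLeft_inv_hom_assoc]
  simp only [swap_nat₃_assoc, ← whiskerLeft_comp_assoc, swap_swap_assoc]

lemma wr_seqAct (T : C) {A B D S R : C} (f : S ⊗ A ⟶ S ⊗ B) (g : R ⊗ B ⟶ R ⊗ D) :
    wr T (seqAct f g) = seqAct (wr T f) (wr T g) := by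
  rw [seqAct_eq, seqAct_eq, thru_wr_aux]
  simp only [wr]
  monoidal

/-- associativity of sequential composition, up to the associator of the state spaces -/
lemma seqAct_assoc {A B D E S T R : C} (f : S ⊗ A ⟶ S ⊗ B) (g : T ⊗ B ⟶ T ⊗ D)
    (h : R ⊗ D ⟶ R ⊗ E) :
    seqAct (seqAct f g) h ≫ (α_ S T R).hom ▷ E = (α_ S T R).hom ▷ A ≫ seqAct f (seqAct g h) := by
  rw [seqAct_eq (seqAct f g), thru_seqAct, seqAct_eq (thru R f), seqAct_eq f, seqAct_eq g,
    thru_tensor]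
  simp only [whiskerLeft_comp, Category.assoc]
  monoidal

/-- the exchange law, up to the symmetry of the state spaces -/
lemma seqAct_exchange {A B A' B' S S' : C} (f : S ⊗ A ⟶ S ⊗ B) (f' : S' ⊗ A' ⟶ S' ⊗ B') :
    seqAct (wr A' f) (thru B f') ≫ (β_ S S').hom ▷ (B ⊗ B') =
      (β_ S S').hom ▷ (A ⊗ A') ≫ seqAct (thru A f') (wr B' f) := by
  have e : seqAct (thru A f') (wr B' f) =
      (α_ S' S (A ⊗ A')).hom ≫ S' ◁ wr A' f ≫ thru S (thru B f') ≫ (α_ S' S (B ⊗ B')).inv := by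
    have h1 := thru_tensor (T := S) (R := A) f'
    have h2 := thru_tensor (T := S) (R := B) f'
    have h := thru_nat f f'
    rw [h1, h2] at h
    have h3 := S' ◁ (α_ S A A').inv ≫= h =≫ S' ◁ (α_ S B B').hom
    simp only [Category.assoc, ← whiskerLeft_comp, ← whiskerLeft_comp_assoc, Iso.inv_hom_id,
      Iso.inv_hom_id_assoc, whiskerLeft_id, Category.id_comp, Category.comp_id] at h3
    simp only [← Category.assoc, ← whiskerLeft_comp] at h3
    rw [seqAct_eq]
    have h4 : thru S (thru A f') ≫ S' ◁ wr B' f = S' ◁ wr A' f ≫ thru S (thru B f') := by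
      simpa [wr] using h3
    rw [reassoc_of% h4]
  have b1 : (β_ S S').hom ▷ (A ⊗ A') ≫ (α_ S' S (A ⊗ A')).hom =
      (α_ S S' (A ⊗ A')).hom ≫ swap S S' (A ⊗ A') := by simp [swap]
  have b2 : (α_ S S' (B ⊗ B')).inv ≫ (β_ S S').hom ▷ (B ⊗ B') =
      swap S S' (B ⊗ B') ≫ (α_ S' S (B ⊗ B')).inv := by simp [swap]
  rw [e, reassoc_of% b1, seqAct_eq]
  simp only [Category.assoc]
  rw [b2]
  rw [show thru S (thru B f') = swap S' S _ ≫ S ◁ thru B f' ≫ swap S S' _ from rfl,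
    show thru S' (wr A' f) = swap S S' _ ≫ S' ◁ wr A' f ≫ swap S' S _ from rfl]
  simp

@[simp]
lemma thru_id (T S A : C) : thru T (𝟙 (S ⊗ A)) = 𝟙 _ := by
  simp [thru]

@[simp]
lemma wr_id (T S A : C) : wr T (𝟙 (S ⊗ A)) = 𝟙 _ := by
  simp [wr]

/-- precomposing with a stateless morphism -/
lemma seqAct_left {A B D R : C} (f : A ⟶ B) (g : R ⊗ B ⟶ R ⊗ D) :
    seqAct (𝟙_ C ◁ f) g ≫ (λ_ R).hom ▷ D = (λ_ R).hom ▷ A ≫ R ◁ f ≫ g := by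
  rw [seqAct_eq, thru_left]
  monoidal

/-- postcomposing with a stateless morphism -/
lemma seqAct_right {A B D S : C} (f : S ⊗ A ⟶ S ⊗ B) (g : B ⟶ D) :
    seqAct f (𝟙_ C ◁ g) ≫ (ρ_ S).hom ▷ D = (ρ_ S).hom ▷ A ≫ f ≫ S ◁ g := by
  rw [seqAct_eq, thru_unit]
  monoidal

namespace St

/-- Sequential composition of stateful processes. -/
def Hom.comp {A B D : C} : St.Hom A B → St.Hom B D → St.Hom A D :=
  Quotient.map₂ (fun x y => ⟨x.state ⊗ y.state, seqAct x.act y.act⟩) (by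
    intro x x' hx y y' hy
    obtain ⟨h, e⟩ := (StatefulMap.rel_iff x x').1 hx
    obtain ⟨k, e'⟩ := (StatefulMap.rel_iff y y').1 hy
    exact (StatefulMap.rel_iff _ _).2 ⟨h ⊗ᵢ k, seqAct_conj _ _ e e'⟩)

/-- Parallel composition of stateful processes. -/
def Hom.tensor {A B A' B' : C} : St.Hom A B → St.Hom A' B' → St.Hom (A ⊗ A') (B ⊗ B') :=
  Quotient.map₂ (fun x y => ⟨x.state ⊗ y.state, parAct x.act y.act⟩) (by
    intro x x' hx y y' hy
    obtain ⟨h, e⟩ := (StatefulMap.rel_iff x x').1 hx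
    obtain ⟨k, e'⟩ := (StatefulMap.rel_iff y y').1 hy
    refine (StatefulMap.rel_iff _ _).2 ⟨h ⊗ᵢ k, ?_⟩
    dsimp only
    rw [parAct_eq, parAct_eq]
    exact seqAct_conj _ _ (wr_conj _ _ _ e) (thru_conj _ _ _ e'))

/-- The category of stateful processes. The identity is `(I ∣ 𝟙)`. -/
instance category : Category (St C) where
  Hom A B := St.Hom A.of B.of
  id A := St.Hom.mk (𝟙_ C) (𝟙 (𝟙_ C ⊗ A.of))
  comp f g := St.Hom.comp f g
  id_comp f := by
    induction f using Hom.ind with | h S f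
    exact Hom.sound (λ_ S) (by simpa using seqAct_left (𝟙 _) f)
  comp_id f := by
    induction f using Hom.ind with | h S f
    exact Hom.sound (ρ_ S) (by simpa using seqAct_right f (𝟙 _))
  assoc f g h := by
    induction f using Hom.ind with | h S f
    induction g using Hom.ind with | h T g
    induction h using Hom.ind with | h R h
    exact Hom.sound (α_ S T R) (seqAct_assoc f g h)

/-- The stateful process `(S ∣ f) : A ⟶ B`. -/
def process {A B : C} (S : C) (f : S ⊗ A ⟶ S ⊗ B) : (⟨A⟩ : St C) ⟶ ⟨B⟩ :=
  Hom.mk S f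

lemma hom_ind {A B : C} {p : ((⟨A⟩ : St C) ⟶ ⟨B⟩) → Prop} (h : ∀ S f, p (process S f)) (x) : p x :=
  Hom.ind h x

lemma process_eq {A B S T : C} {f : S ⊗ A ⟶ S ⊗ B} {g : T ⊗ A ⟶ T ⊗ B} (h : S ≅ T)
    (w : f ≫ h.hom ▷ B = h.hom ▷ A ≫ g) : process S f = process T g :=
  Hom.sound h w

lemma process_comp {A B D S T : C} (f : S ⊗ A ⟶ S ⊗ B) (g : T ⊗ B ⟶ T ⊗ D) :
    process S f ≫ process T g = process (S ⊗ T) (seqAct f g) := rfl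

lemma id_eq (A : St C) : 𝟙 A = process (𝟙_ C) (𝟙 (𝟙_ C ⊗ A.of)) := rfl

/-- The stateless process `(I ∣ I ⊗ f)`. -/
def pureMap {A B : C} (f : A ⟶ B) : (⟨A⟩ : St C) ⟶ ⟨B⟩ := process (𝟙_ C) (𝟙_ C ◁ f)

lemma pureMap_comp_process {A B D S : C} (f : A ⟶ B) (g : S ⊗ B ⟶ S ⊗ D) :
    pureMap f ≫ process S g = process S (S ◁ f ≫ g) :=
  process_eq (λ_ S) (seqAct_left f g)

lemma process_comp_pureMap {A B D S : C} (f : S ⊗ A ⟶ S ⊗ B) (g : B ⟶ D) :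
    process S f ≫ pureMap g = process S (f ≫ S ◁ g) :=
  process_eq (ρ_ S) (seqAct_right f g)

lemma pureMap_id (A : C) : pureMap (𝟙 A) = 𝟙 (⟨A⟩ : St C) := by
  simp [pureMap, id_eq]

lemma pureMap_comp {A B D : C} (f : A ⟶ B) (g : B ⟶ D) :
    pureMap (f ≫ g) = pureMap f ≫ pureMap g := by
  rw [show pureMap g = process _ _ from rfl, pureMap_comp_process, pureMap, whiskerLeft_comp]

/-- An isomorphism of `C`, as an isomorphism of stateless processes. -/
@[simps]
def pureIso {A B : C} (e : A ≅ B) : (⟨A⟩ : St C) ≅ ⟨B⟩ where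
  hom := pureMap e.hom
  inv := pureMap e.inv
  hom_inv_id := by rw [← pureMap_comp, e.hom_inv_id, pureMap_id]
  inv_hom_id := by rw [← pureMap_comp, e.inv_hom_id, pureMap_id]

@[simp]
lemma parAct_id (A A' S S' : C) : parAct (𝟙 (S ⊗ A)) (𝟙 (S' ⊗ A')) = 𝟙 _ := by
  rw [parAct_eq, seqAct_eq]; simp

/-- The tensor product of stateful processes. -/
def tensor {A B A' B' : St C} (f : A ⟶ B) (f' : A' ⟶ B') :
    (⟨A.of ⊗ A'.of⟩ : St C) ⟶ ⟨B.of ⊗ B'.of⟩ := Hom.tensor f f'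

lemma tensor_process {A B A' B' S S' : C} (f : S ⊗ A ⟶ S ⊗ B) (f' : S' ⊗ A' ⟶ S' ⊗ B') :
    tensor (process S f) (process S' f') = process (S ⊗ S') (parAct f f') := rfl

lemma tensor_id_right {A B S : C} (f : S ⊗ A ⟶ S ⊗ B) (X : St C) :
    tensor (process S f) (𝟙 X) = process S (wr X.of f) := by
  rw [id_eq, tensor_process, parAct_eq]
  rw [thru_id, ← whiskerLeft_id]
  exact process_eq (ρ_ S) (by rw [seqAct_right]; simp)

lemma tensor_id_left {A B S : C} (f : S ⊗ A ⟶ S ⊗ B) (X : St C) :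
    tensor (𝟙 X) (process S f) = process S (thru X.of f) := by
  rw [id_eq, tensor_process, parAct_eq]
  rw [wr_id, ← whiskerLeft_id]
  exact process_eq (λ_ S) (by rw [seqAct_left]; simp)

lemma tensor_comp_left {A B D : St C} (f : A ⟶ B) (g : B ⟶ D) (X : St C) :
    tensor (𝟙 X) (f ≫ g) = tensor (𝟙 X) f ≫ tensor (𝟙 X) g := by
  induction f using hom_ind with | h S f
  induction g using hom_ind with | h T g
  rw [process_comp, tensor_id_left, tensor_id_left, tensor_id_left, process_comp, thru_seqAct]

lemma tensor_comp_right {A B D : St C} (f : A ⟶ B) (g : B ⟶ D) (X : St C) :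
    tensor (f ≫ g) (𝟙 X) = tensor f (𝟙 X) ≫ tensor g (𝟙 X) := by
  induction f using hom_ind with | h S f
  induction g using hom_ind with | h T g
  rw [process_comp, tensor_id_right, tensor_id_right, tensor_id_right, process_comp, wr_seqAct]

lemma tensor_eq {A B A' B' : St C} (f : A ⟶ B) (f' : A' ⟶ B') :
    tensor f f' = tensor f (𝟙 A') ≫ tensor (𝟙 B) f' := by
  induction f using hom_ind with | h S f
  induction f' using hom_ind with | h T g
  rw [tensor_id_right, tensor_id_left, tensor_process, process_comp, parAct_eq]

lemma tensor_eq' {A B A' B' : St C} (f : A ⟶ B) (f' : A' ⟶ B') :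
    tensor f f' = tensor (𝟙 A) f' ≫ tensor f (𝟙 B') := by
  induction f using hom_ind with | h S f
  induction f' using hom_ind with | h T g
  rw [tensor_id_right, tensor_id_left, tensor_process, process_comp, parAct_eq]
  exact process_eq (β_ S T) (seqAct_exchange f g)

lemma pureMap_tensor_id {A B : C} (f : A ⟶ B) (X : C) :
    tensor (pureMap f) (𝟙 (⟨X⟩ : St C)) = pureMap (f ▷ X) := by
  rw [pureMap, tensor_id_right, wr_left, pureMap]

lemma id_tensor_pureMap {A B : C} (f : A ⟶ B) (X : C) :
    tensor (𝟙 (⟨X⟩ : St C)) (pureMap f) = pureMap (X ◁ f) := by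
  rw [pureMap, tensor_id_left, thru_left, pureMap]

lemma tensor_id_id (A B : St C) : tensor (𝟙 A) (𝟙 B) = 𝟙 (⟨A.of ⊗ B.of⟩ : St C) := by
  rw [← pureMap_id, pureMap_tensor_id, id_whiskerRight, pureMap_id]

lemma tensor_comp {A B D A' B' D' : St C} (f : A ⟶ B) (f' : A' ⟶ B') (g : B ⟶ D)
    (g' : B' ⟶ D') : tensor f f' ≫ tensor g g' = tensor (f ≫ g) (f' ≫ g') := by
  have h : tensor (𝟙 B) f' ≫ tensor g (𝟙 B') = tensor g (𝟙 A') ≫ tensor (𝟙 D) f' := by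
    rw [← tensor_eq', tensor_eq]
  rw [tensor_eq (f ≫ g), tensor_comp_left, tensor_comp_right, tensor_eq f f', tensor_eq g g']
  simp only [Category.assoc]
  rw [reassoc_of% h]

lemma tensor_assoc₁ {A B : St C} (f : A ⟶ B) (X Y : St C) :
    tensor (tensor f (𝟙 X)) (𝟙 Y) ≫ pureMap (α_ B.of X.of Y.of).hom =
      pureMap (α_ A.of X.of Y.of).hom ≫ tensor f (𝟙 (⟨X.of ⊗ Y.of⟩ : St C)) := by
  induction f using hom_ind with | h S f
  rw [tensor_id_right, tensor_id_right, tensor_id_right, process_comp_pureMap,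
    pureMap_comp_process, wr_tensor]
  simp

lemma tensor_assoc₂ {A B : St C} (f : A ⟶ B) (X Y : St C) :
    tensor (tensor (𝟙 X) f) (𝟙 Y) ≫ pureMap (α_ X.of B.of Y.of).hom =
      pureMap (α_ X.of A.of Y.of).hom ≫ tensor (𝟙 X) (tensor f (𝟙 Y)) := by
  induction f using hom_ind with | h S f
  rw [tensor_id_right, tensor_id_left, tensor_id_right, tensor_id_left, process_comp_pureMap,
    pureMap_comp_process, thru_wr_aux]
  simp

lemma tensor_assoc₃ {A B : St C} (f : A ⟶ B) (X Y : St C) :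
    tensor (𝟙 (⟨X.of ⊗ Y.of⟩ : St C)) f ≫ pureMap (α_ X.of Y.of B.of).hom =
      pureMap (α_ X.of Y.of A.of).hom ≫ tensor (𝟙 X) (tensor (𝟙 Y) f) := by
  induction f using hom_ind with | h S f
  rw [tensor_id_left, tensor_id_left, tensor_id_left, process_comp_pureMap,
    pureMap_comp_process, thru_tensor]
  simp

lemma tensor_assoc {A A' A'' B B' B'' : St C} (f : A ⟶ B) (f' : A' ⟶ B') (f'' : A'' ⟶ B'') :
    tensor (tensor f f') f'' ≫ pureMap (α_ B.of B'.of B''.of).hom =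
      pureMap (α_ A.of A'.of A''.of).hom ≫ tensor f (tensor f' f'') := by
  rw [tensor_eq (tensor f f'), tensor_eq f f', tensor_comp_right, tensor_eq f (tensor f' f''),
    tensor_eq f' f'', tensor_comp_left]
  simp only [Category.assoc]
  rw [tensor_assoc₃, reassoc_of% (tensor_assoc₂ f' B A''), reassoc_of% (tensor_assoc₁ f A' A'')]

instance monoidalStruct : MonoidalCategoryStruct (St C) where
  tensorObj A B := ⟨A.of ⊗ B.of⟩
  tensorHom f g := tensor f g
  whiskerLeft A _ _ f := tensor (𝟙 A) f
  whiskerRight f A := tensor f (𝟙 A)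
  tensorUnit := ⟨𝟙_ C⟩
  associator A B D := pureIso (α_ A.of B.of D.of)
  leftUnitor A := pureIso (λ_ A.of)
  rightUnitor A := pureIso (ρ_ A.of)

/-- The monoidal category of stateful processes; its structure morphisms are those of `C`. -/
instance monoidal : MonoidalCategory (St C) := MonoidalCategory.ofTensorHom
  (id_tensorHom_id := tensor_id_id)
  (id_tensorHom := fun _ _ _ _ => rfl)
  (tensorHom_id := fun _ _ => rfl)
  (tensorHom_comp_tensorHom := tensor_comp)
  (associator_naturality := tensor_assoc)
  (leftUnitor_naturality := by
    intro ⟨A⟩ ⟨B⟩ f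
    induction f using hom_ind with | h S f
    change tensor (𝟙 (⟨𝟙_ C⟩ : St C)) (process S f) ≫ pureMap (λ_ B).hom =
      pureMap (λ_ A).hom ≫ process S f
    rw [tensor_id_left, process_comp_pureMap, pureMap_comp_process, thru_unit]
    simp)
  (rightUnitor_naturality := by
    intro ⟨A⟩ ⟨B⟩ f
    induction f using hom_ind with | h S f
    change tensor (process S f) (𝟙 (⟨𝟙_ C⟩ : St C)) ≫ pureMap (ρ_ B).hom =
      pureMap (ρ_ A).hom ≫ process S f
    rw [tensor_id_right, process_comp_pureMap, pureMap_comp_process, wr]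
    simp)
  (pentagon := by
    intro ⟨W⟩ ⟨X⟩ ⟨Y⟩ ⟨Z⟩
    change tensor (pureMap (α_ W X Y).hom) (𝟙 _) ≫ pureMap (α_ W (X ⊗ Y) Z).hom ≫
        tensor (𝟙 _) (pureMap (α_ X Y Z).hom) =
      pureMap (α_ (W ⊗ X) Y Z).hom ≫ pureMap (α_ W X (Y ⊗ Z)).hom
    rw [pureMap_tensor_id, id_tensor_pureMap, ← pureMap_comp, ← pureMap_comp, ← pureMap_comp,
      MonoidalCategory.pentagon])
  (triangle := by
    intro ⟨X⟩ ⟨Y⟩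
    change pureMap (α_ X (𝟙_ C) Y).hom ≫ tensor (𝟙 _) (pureMap (λ_ Y).hom) =
      tensor (pureMap (ρ_ X).hom) (𝟙 _)
    rw [pureMap_tensor_id, id_tensor_pureMap, ← pureMap_comp, MonoidalCategory.triangle])

/-- The symmetry of stateful processes is that of `C`. -/
instance symmetric : SymmetricCategory (St C) where
  braiding A B := pureIso (β_ A.of B.of)
  braiding_naturality_right := by
    intro ⟨X⟩ ⟨A⟩ ⟨B⟩ f
    induction f using hom_ind with | h S f
    change tensor (𝟙 _) (process S f) ≫ pureMap (β_ X B).hom =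
      pureMap (β_ X A).hom ≫ tensor (process S f) (𝟙 _)
    rw [tensor_id_left, tensor_id_right, process_comp_pureMap, pureMap_comp_process, thru_eq_wr]
    simp only [Category.assoc]
    rw [← whiskerLeft_comp, SymmetricCategory.symmetry, whiskerLeft_id, Category.comp_id]
  braiding_naturality_left := by
    intro ⟨A⟩ ⟨B⟩ f ⟨X⟩
    induction f using hom_ind with | h S f
    change tensor (process S f) (𝟙 _) ≫ pureMap (β_ B X).hom =
      pureMap (β_ A X).hom ≫ tensor (𝟙 _) (process S f)
    rw [tensor_id_left, tensor_id_right, process_comp_pureMap, pureMap_comp_process, thru_eq_wr]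
    rw [← whiskerLeft_comp_assoc, SymmetricCategory.symmetry, whiskerLeft_id, Category.id_comp]
  hexagon_forward := by
    intro ⟨X⟩ ⟨Y⟩ ⟨Z⟩
    change pureMap (α_ X Y Z).hom ≫ pureMap (β_ X (Y ⊗ Z)).hom ≫ pureMap (α_ Y Z X).hom =
      tensor (pureMap (β_ X Y).hom) (𝟙 _) ≫ pureMap (α_ Y X Z).hom ≫
        tensor (𝟙 _) (pureMap (β_ X Z).hom)
    rw [pureMap_tensor_id, id_tensor_pureMap]
    simp only [← pureMap_comp, BraidedCategory.hexagon_forward]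
  hexagon_reverse := by
    intro ⟨X⟩ ⟨Y⟩ ⟨Z⟩
    change pureMap (α_ X Y Z).inv ≫ pureMap (β_ (X ⊗ Y) Z).hom ≫ pureMap (α_ Z X Y).inv =
      tensor (𝟙 _) (pureMap (β_ Y Z).hom) ≫ pureMap (α_ X Z Y).inv ≫
        tensor (pureMap (β_ X Z).hom) (𝟙 _)
    rw [pureMap_tensor_id, id_tensor_pureMap]
    simp only [← pureMap_comp, BraidedCategory.hexagon_reverse]
  symmetry := by
    intro ⟨X⟩ ⟨Y⟩
    change pureMap (β_ X Y).hom ≫ pureMap (β_ Y X).hom = 𝟙 _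
    rw [← pureMap_comp, SymmetricCategory.symmetry, pureMap_id]

/-- The operator `store_T (S ∣ f) = (S ⊗ T ∣ f)` on stateful processes. -/
def store : FeedbackOperator (St C) := fun T A B =>
  Quotient.map (fun x : StatefulMap (T.of ⊗ A.of) (T.of ⊗ B.of) =>
      (⟨x.state ⊗ T.of, (α_ x.state T.of A.of).hom ≫ x.act ≫ (α_ x.state T.of B.of).inv⟩ :
        StatefulMap A.of B.of)) (by
    intro x y hxy
    obtain ⟨h, e⟩ := (StatefulMap.rel_iff x y).1 hxy
    refine (StatefulMap.rel_iff _ _).2 ⟨whiskerRightIso h T.of, ?_⟩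
    have e' : x.act ≫ h.hom ▷ (T.of ⊗ B.of) = h.hom ▷ (T.of ⊗ A.of) ≫ y.act := e
    rw [whiskerRight_tensor, whiskerRight_tensor] at e'
    simp only [whiskerRightIso_hom, Category.assoc]
    rw [← cancel_mono (α_ y.state T.of B.of).hom]
    simpa using (α_ x.state T.of A.of).hom ≫= e')

/-- The inclusion `A ↦ A`, `f ↦ (I ∣ I ⊗ f)` of a symmetric monoidal category into its category of
stateful processes. -/
@[simps]
def incl (C : Type u) [Category.{v} C] [MonoidalCategory C] [SymmetricCategory C] : C ⥤ St C where
  obj A := ⟨A⟩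
  map f := pureMap f
  map_id A := pureMap_id A
  map_comp f g := pureMap_comp f g

/-- The inclusion is strong (in fact strict) monoidal. -/
def inclCoreMonoidal : (incl C).CoreMonoidal where
  εIso := Iso.refl _
  μIso _ _ := Iso.refl _
  μIso_hom_natural_left f X := by
    refine (Category.comp_id _).trans (Eq.trans ?_ (Category.id_comp _).symm)
    exact pureMap_tensor_id f X
  μIso_hom_natural_right X f := by
    refine (Category.comp_id _).trans (Eq.trans ?_ (Category.id_comp _).symm)
    exact id_tensor_pureMap f X
  associativity X Y Z := by
    change (𝟙 _ ▷ _) ≫ 𝟙 _ ≫ pureMap (α_ X Y Z).hom = pureMap (α_ X Y Z).hom ≫ (_ ◁ 𝟙 _) ≫ 𝟙 _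
    rw [id_whiskerRight, whiskerLeft_id, Category.id_comp, Category.id_comp]
    exact (Category.comp_id (pureMap (α_ X Y Z).hom)).symm.trans
      (congrArg (fun t => pureMap (α_ X Y Z).hom ≫ t)
        (Category.id_comp (𝟙 (⟨X ⊗ Y ⊗ Z⟩ : St C))).symm)
  left_unitality X := by
    change pureMap (λ_ X).hom = (𝟙 _ ▷ _) ≫ 𝟙 _ ≫ pureMap (λ_ X).hom
    rw [id_whiskerRight]
    exact ((Category.id_comp _).trans (Category.id_comp _)).symm
  right_unitality X := by
    change pureMap (ρ_ X).hom = (_ ◁ 𝟙 _) ≫ 𝟙 _ ≫ pureMap (ρ_ X).hom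
    rw [whiskerLeft_id]
    exact ((Category.id_comp _).trans (Category.id_comp _)).symm

instance inclMonoidal : (incl C).Monoidal := inclCoreMonoidal.toMonoidal

instance inclBraided : (incl C).Braided where
  braided X Y := by
    refine (Category.id_comp _).trans (Category.comp_id _).symm

/-- The inclusion of `C` into its stateful processes, as a strong symmetric monoidal functor. -/
def inclusion (C : Type u) [Category.{v} C] [MonoidalCategory C] [SymmetricCategory C] :
    SymmetricMonoidalFunctor C (St C) where
  functor := incl C

end St
end Stateful

section Graphs

open WalkingParallelPair

/-- Graphs in `C`: functors from the diagram `• ⇉ •` to `C`. The object `zero` is sent to the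
edges, `one` to the vertices, `left` to the source map, and `right` to the target map. -/
abbrev GraphIn (C : Type u) [Category.{v} C] := WalkingParallelPair ⥤ C

/-- The category of (small) graphs. -/
abbrev Grph : Type (u + 1) := GraphIn (Type u)

/-- The graph with edges `E`, vertices `V`, source map `s` and target map `t`. -/
def graph {E V : Type u} (s t : E ⟶ V) : Grph.{u} := parallelPair s t

/-- The unique function from the empty set. -/
def fromEmpty (V : Type u) : (PEmpty.{u + 1} : Type u) ⟶ V := ↾(fun x : PEmpty => x.elim)

/-- The discrete graph `∅ ⇉ V` on the set of vertices `V`. -/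
def discreteGraph (V : Type u) : Grph.{u} := graph (fromEmpty V) (fromEmpty V)

/-- The morphism from a discrete graph that is given by a function to the vertices. -/
def mark {X : Type u} (G : Grph.{u}) (l : X ⟶ G.obj one) : discreteGraph X ⟶ G :=
  parallelPairHomMk (fromEmpty (G.obj zero)) l (by ext x; exact x.elim) (by ext x; exact x.elim)

/-- The discrete graphs on a set are, up to isomorphism, the graphs without edges. -/
lemma isEmpty_edges_iff (G : Grph.{u}) :
    IsEmpty (G.obj zero) ↔ Nonempty (discreteGraph (G.obj one) ≅ G) := by
  constructor
  · intro h
    have : IsEmpty ((discreteGraph (G.obj one)).obj zero) :=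
      inferInstanceAs (IsEmpty PEmpty.{u + 1})
    refine ⟨parallelPairIsoMk (Equiv.toIso (Equiv.equivOfIsEmpty _ _)) (Iso.refl _) ?_ ?_⟩ <;>
    · ext x; exact x.elim
  · rintro ⟨e⟩
    exact ⟨fun x => (e.inv.app zero x : PEmpty).elim⟩

/-- The objects of `Cospan(Graph)` that are discrete graphs `∅ ⇉ V`. -/
def isDiscrete : ObjectProperty (Cospan Grph.{u}) := fun G => ∃ V : Type u, G = ⟨discreteGraph V⟩

/-- `Cospan(Graph)_*`, the full subcategory of `Cospan(Graph)` on the discrete graphs. -/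
abbrev DiscreteCospan : Type (u + 1) := (isDiscrete.{u}).FullSubcategory

/-- The discrete graph on `V`, as an object of `Cospan(Graph)_*`. -/
def DiscreteCospan.of (V : Type u) : DiscreteCospan.{u} := ⟨⟨discreteGraph V⟩, V, rfl⟩

/-- A graph with two functions `l` and `r` that mark its boundary vertices, as a morphism of
`Cospan(Graph)_*`. -/
noncomputable def markedGraph {X Y : Type u} (G : Grph.{u}) (l : X ⟶ G.obj one)
    (r : Y ⟶ G.obj one) : DiscreteCospan.of X ⟶ DiscreteCospan.of Y :=
  ObjectProperty.homMk (Cospan.cospan (mark G l) (mark G r))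

/-- The morphism `(E ∣ E + A ⟶ V ⟵ E + B)` of `St(Cospan(Set))`. -/
noncomputable def statefulCospan {A B V : Type u} (E : Type u) (l : E ⨿ A ⟶ V) (r : E ⨿ B ⟶ V) :
    (⟨⟨A⟩⟩ : St (Cospan (Type u))) ⟶ ⟨⟨B⟩⟩ :=
  St.process (A := (⟨A⟩ : Cospan (Type u))) (B := ⟨B⟩) ⟨E⟩ (Cospan.cospan l r)

end Graphs

end FreeFeedback

open FreeFeedback CategoryTheory Limits

/-!
For every symmetric monoidal category `C`, the operator `store` satisfies the axioms of feedback
with one proviso: the sliding axiom quantifies over the isomorphisms of `St C`, and `store` slides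
those that come from `C` (`St.store_isFeedback`). When all isomorphisms of `St C` come from `C`,
`St C` is the free feedback category (`St.isFreeFeedbackCategory`). The extension of a strong
symmetric monoidal functor `F` sends `(S ∣ f)` to the feedback on `F S` of `μ ≫ F f ≫ μ⁻¹`. It
preserves composition because feedback of a sequential composite can be taken one state space at a
time (`FeedbackOperator.IsFeedback.fbk_seqAct`), and it is the only extension because `(S ∣ f)` is
`store_S` of the image of `f` under the inclusion (`St.store_pureMap`).

For cospans of sets the proviso holds. Pushouts of monomorphisms of sets are monomorphisms, so the
legs of an invertible cospan are bijections (`Cospan.exists_eq_liftIso`). If `(S ∣ f)` is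
invertible then `S` has a tensor inverse, so `S` is empty (`Cospan.nonempty_iso_unit`), and
`(S ∣ f)` is stateless (`St.exists_iso_of_iso`).

A stateful cospan `E + A ⟶ V ⟵ E + B` has the same data as a graph `E ⇉ V` with marked vertices
`A ⟶ V ⟵ B`. As isomorphisms of cospans are bijections, two stateful cospans are equal exactly when
there are bijections of edges and of vertices that respect the four functions
(`statefulCospan_eq_iff`), which is also the condition for the marked graphs to be equal
(`toMarkedGraph_eq_iff`). Both compositions take the disjoint union of the edges and glue the
vertices along the common boundary (`Cospan.seqAct_cospan`, `markedGraph_comp`). Thus the comparison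
is a functor, which is fully faithful and bijective on objects.
-/

namespace FreeFeedback

open MonoidalCategory

/-! ### The feedback operator on stateful processes -/

section Store
variable {C : Type u} [Category.{v} C] [MonoidalCategory C] [SymmetricCategory C]

namespace St

lemma store_process {T A B S : C} (f : S ⊗ (T ⊗ A) ⟶ S ⊗ (T ⊗ B)) :
    store ⟨T⟩ ⟨A⟩ ⟨B⟩ (process S f) =
      process (S ⊗ T) ((α_ S T A).hom ≫ f ≫ (α_ S T B).inv) := rfl

/-- Every stateful process is a stored stateless one. -/
lemma store_pureMap {S A B : C} (f : S ⊗ A ⟶ S ⊗ B) :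
    store ⟨S⟩ ⟨A⟩ ⟨B⟩ (pureMap f) = process S f := by
  rw [pureMap, store_process]
  exact process_eq (λ_ S) (by monoidal)

/-- Tightening on the input side. -/
lemma comp_store {T A A' B : C} (u : (⟨A'⟩ : St C) ⟶ ⟨A⟩)
    (f : (⟨T ⊗ A⟩ : St C) ⟶ ⟨T ⊗ B⟩) :
    u ≫ store ⟨T⟩ ⟨A⟩ ⟨B⟩ f = store ⟨T⟩ ⟨A'⟩ ⟨B⟩ (tensor (𝟙 (⟨T⟩ : St C)) u ≫ f) := by
  induction u using hom_ind with | h U u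
  induction f using hom_ind with | h R f
  rw [tensor_id_left, store_process, process_comp, process_comp, store_process]
  refine process_eq (α_ U R T).symm ?_
  rw [seqAct_eq, seqAct_eq, thru_tensor]
  simp only [Category.assoc, Iso.symm_hom]
  monoidal

/-- Tightening on the output side. -/
lemma store_comp {T A B B' : C} (f : (⟨T ⊗ A⟩ : St C) ⟶ ⟨T ⊗ B⟩)
    (v : (⟨B⟩ : St C) ⟶ ⟨B'⟩) :
    store ⟨T⟩ ⟨A⟩ ⟨B⟩ f ≫ v = store ⟨T⟩ ⟨A⟩ ⟨B'⟩ (f ≫ tensor (𝟙 (⟨T⟩ : St C)) v) := by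
  induction f using hom_ind with | h R f
  induction v using hom_ind with | h V v
  rw [tensor_id_left, store_process, process_comp, process_comp, store_process]
  -- the two state spaces list `T` and `V` in opposite orders
  refine process_eq (α_ R T V ≪≫ whiskerLeftIso R (β_ T V) ≪≫ (α_ R V T).symm) ?_
  rw [seqAct_eq, seqAct_eq]
  have e1 : thru V ((α_ R T A).hom ≫ f ≫ (α_ R T B).inv) =
      (α_ R T (V ⊗ A)).hom ≫ R ◁ swap T V A ≫ thru V f ≫ R ◁ swap V T B ≫
        (α_ R T (V ⊗ B)).inv := by
    simp only [thru, swap_tensor₁, swap_tensor₂]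
    simp
  rw [e1]
  have e2 : (α_ R T V ≪≫ whiskerLeftIso R (β_ T V) ≪≫ (α_ R V T).symm).hom ▷ A ≫
      (α_ (R ⊗ V) T A).hom ≫ (α_ R V (T ⊗ A)).hom =
      (α_ (R ⊗ T) V A).hom ≫ (α_ R T (V ⊗ A)).hom ≫ R ◁ swap T V A := by
    simp [swap]
  have e3 : (α_ R T (V ⊗ B')).inv ≫ (α_ (R ⊗ T) V B').inv ≫
      (α_ R T V ≪≫ whiskerLeftIso R (β_ T V) ≪≫ (α_ R V T).symm).hom ▷ B' =
      R ◁ swap T V B' ≫ (α_ R V (T ⊗ B')).inv ≫ (α_ (R ⊗ V) T B').inv := by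
    simp [swap]
  have e4 : thru T v = swap V T B ≫ T ◁ v ≫ swap T V B' := rfl
  have e5 : (R ⊗ T) ◁ v ≫ (α_ (R ⊗ T) V B').inv = (α_ R T (V ⊗ B)).hom ≫ R ◁ T ◁ v ≫
      (α_ R T (V ⊗ B')).inv ≫ (α_ (R ⊗ T) V B').inv := by simp
  simp only [Category.assoc]
  rw [reassoc_of% e2, reassoc_of% e5, e3, e4]
  simp only [whiskerLeft_comp, Category.assoc, Iso.inv_hom_id_assoc]

/-- Strength, for the tensor product with an identity. Together with tightening it yields the
general case. -/
lemma tensor_store_id {T A B : C} (f : (⟨T ⊗ A⟩ : St C) ⟶ ⟨T ⊗ B⟩) (X : C) :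
    tensor (store ⟨T⟩ ⟨A⟩ ⟨B⟩ f) (𝟙 (⟨X⟩ : St C)) = store ⟨T⟩ ⟨A ⊗ X⟩ ⟨B ⊗ X⟩
      (pureMap (α_ T A X).inv ≫ tensor f (𝟙 (⟨X⟩ : St C)) ≫ pureMap (α_ T B X).hom) := by
  induction f using hom_ind with | h R f
  rw [tensor_id_right, store_process, tensor_id_right, process_comp_pureMap,
    pureMap_comp_process, store_process]
  congr 1
  simp only [wr]
  monoidal

lemma store_vanishing {A B : C} (f : (⟨A⟩ : St C) ⟶ ⟨B⟩) :
    store ⟨𝟙_ C⟩ ⟨A⟩ ⟨B⟩ (pureMap (λ_ A).hom ≫ f ≫ pureMap (λ_ B).inv) = f := by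
  induction f using hom_ind with | h R f
  rw [process_comp_pureMap, pureMap_comp_process, store_process]
  refine process_eq (ρ_ R) ?_
  monoidal

lemma store_joining {S T A B : C}
    (f : (⟨S ⊗ (T ⊗ A)⟩ : St C) ⟶ ⟨S ⊗ (T ⊗ B)⟩) :
    store ⟨T⟩ ⟨A⟩ ⟨B⟩ (store ⟨S⟩ ⟨T ⊗ A⟩ ⟨T ⊗ B⟩ f) =
      store ⟨S ⊗ T⟩ ⟨A⟩ ⟨B⟩ (pureMap (α_ S T A).hom ≫ f ≫ pureMap (α_ S T B).inv) := by
  induction f using hom_ind with | h R f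
  rw [process_comp_pureMap, pureMap_comp_process, store_process, store_process, store_process]
  refine process_eq (α_ R S T) ?_
  monoidal

/-- Sliding, for an isomorphism that comes from `C`. -/
lemma store_sliding {S T A B : C} (f : (⟨T ⊗ A⟩ : St C) ⟶ ⟨S ⊗ B⟩) (h : S ≅ T) :
    store ⟨T⟩ ⟨A⟩ ⟨B⟩ (f ≫ pureMap (h.hom ▷ B)) =
      store ⟨S⟩ ⟨A⟩ ⟨B⟩ (pureMap (h.hom ▷ A) ≫ f) := by
  induction f using hom_ind with | h R f
  rw [process_comp_pureMap, pureMap_comp_process, store_process, store_process]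
  refine process_eq (whiskerLeftIso R h.symm) ?_
  simp

/-- The inclusion of `C` is faithful: conjugation by an automorphism of the unit object is
trivial, since such an automorphism commutes with every morphism. -/
lemma pureMap_injective {A B : C} {f g : A ⟶ B} (h : pureMap f = pureMap g) : f = g := by
  obtain ⟨k, e⟩ : ∃ k : 𝟙_ C ≅ 𝟙_ C, 𝟙_ C ◁ f ≫ k.hom ▷ B = k.hom ▷ A ≫ 𝟙_ C ◁ g :=
    (StatefulMap.rel_iff _ _).1 (Quotient.exact h)
  rw [← whisker_exchange, cancel_mono, whiskerLeft_iff] at e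
  exact e

/-- The sliding axiom quantifies over the isomorphisms of `St C`, whence the hypothesis: `store`
can only slide the isomorphisms that come from `C`. -/
lemma store_isFeedback
    (hC : ∀ {S T : C} (h : (⟨S⟩ : St C) ≅ ⟨T⟩), ∃ k : S ≅ T, h.hom = pureMap k.hom) :
    (store (C := C)).IsFeedback where
  tightening {S A A' B B'} u f v := (u ≫= store_comp f v).trans (comp_store u _)
  vanishing f := store_vanishing f
  joining f := store_joining f
  strength {S A B A' B'} f g := by
    have e : store S A B f ⊗ₘ g = store S A B f ▷ A' ≫ B ◁ g := MonoidalCategory.tensorHom_def _ _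
    have e' : store S A B f ▷ A' = store S (A ⊗ A') (B ⊗ A')
        ((α_ S A A').inv ≫ f ▷ A' ≫ (α_ S B A').hom) := tensor_store_id f A'.of
    rw [e, e']
    refine (store_comp _ _).trans (congrArg _ ?_)
    change ((α_ S A A').inv ≫ f ▷ A' ≫ (α_ S B A').hom) ≫ S ◁ (B ◁ g) = _
    rw [MonoidalCategory.tensorHom_def]
    simp
  sliding {S T A B} f h := by
    obtain ⟨k, hk⟩ := hC h
    rw [hk]
    have e₁ : pureMap k.hom ▷ B = pureMap (k.hom ▷ B.of) := pureMap_tensor_id _ _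
    have e₂ : pureMap k.hom ▷ A = pureMap (k.hom ▷ A.of) := pureMap_tensor_id _ _
    rw [e₁, e₂]
    exact store_sliding f k

end St
end Store

/-! ### Feedback categories and strong monoidal functors -/

section Extension

namespace FeedbackOperator.IsFeedback

variable {D : Type u'} [Category.{v'} D] [MonoidalCategory D]
  {fbk : FeedbackOperator D}

lemma comp_fbk (hfbk : fbk.IsFeedback) {S A A' B : D} (u : A' ⟶ A) (f : S ⊗ A ⟶ S ⊗ B) :
    u ≫ fbk S A B f = fbk S A' B (S ◁ u ≫ f) := by
  simpa using hfbk.tightening u f (𝟙 B)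

lemma fbk_comp (hfbk : fbk.IsFeedback) {S A B B' : D} (f : S ⊗ A ⟶ S ⊗ B) (v : B ⟶ B') :
    fbk S A B f ≫ v = fbk S A B' (f ≫ S ◁ v) := by
  simpa using hfbk.tightening (𝟙 A) f v

/-- Sliding, for a morphism that is conjugated by an isomorphism of the state spaces. -/
lemma fbk_eq_of_iso (hfbk : fbk.IsFeedback) {S T A B : D} (h : S ≅ T)
    {f : S ⊗ A ⟶ S ⊗ B} {g : T ⊗ A ⟶ T ⊗ B}
    (w : f ≫ h.hom ▷ B = h.hom ▷ A ≫ g) : fbk S A B f = fbk T A B g := by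
  have := hfbk.sliding (h.inv ▷ A ≫ f) h
  rw [Category.assoc, w] at this
  simpa using this.symm

lemma fbk_unit (hfbk : fbk.IsFeedback) {A B : D} (f : A ⟶ B) : fbk (𝟙_ D) A B (𝟙_ D ◁ f) = f := by
  simpa using hfbk.vanishing f

lemma fbk_wr (hfbk : fbk.IsFeedback) {S A B : D} (f : S ⊗ A ⟶ S ⊗ B) (X : D) :
    fbk S (A ⊗ X) (B ⊗ X) (wr X f) = fbk S A B f ▷ X := by
  simpa [wr] using (hfbk.strength f (𝟙 X)).symm

variable [SymmetricCategory D]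

lemma fbk_thru (hfbk : fbk.IsFeedback) {S A B : D} (f : S ⊗ A ⟶ S ⊗ B) (X : D) :
    fbk S (X ⊗ A) (X ⊗ B) (thru X f) = X ◁ fbk S A B f := by
  rw [thru_eq_wr, ← hfbk.tightening, hfbk.fbk_wr]
  simp

/-- Feedback of a sequential composite: the two state spaces can be fed back one at a time, by
joining. -/
lemma fbk_seqAct (hfbk : fbk.IsFeedback) {S T A B E : D} (f : S ⊗ A ⟶ S ⊗ B) (g : T ⊗ B ⟶ T ⊗ E) :
    fbk (S ⊗ T) A E (seqAct f g) = fbk S A B f ≫ fbk T B E g := by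
  have h := hfbk.joining (thru T f ≫ S ◁ g)
  rw [← hfbk.fbk_comp, hfbk.fbk_thru, ← hfbk.comp_fbk] at h
  rw [h, seqAct_eq]
  simp

end FeedbackOperator.IsFeedback

section Transport

open Functor.LaxMonoidal Functor.OplaxMonoidal Functor.Monoidal

variable {C : Type u} [Category.{v} C] [MonoidalCategory C] [SymmetricCategory C]
  {D : Type u'} [Category.{v'} D] [MonoidalCategory D] [SymmetricCategory D]
  (F : C ⥤ D) [F.Braided]

/-- The image `μ ≫ F f ≫ μ⁻¹` under a strong monoidal functor of a morphism between tensor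
products. -/
def mapTensor {S A T B : C} (f : S ⊗ A ⟶ T ⊗ B) : F.obj S ⊗ F.obj A ⟶ F.obj T ⊗ F.obj B :=
  μ F S A ≫ F.map f ≫ δ F T B

@[simp]
lemma mapTensor_comp {S A T B R E : C} (f : S ⊗ A ⟶ T ⊗ B) (g : T ⊗ B ⟶ R ⊗ E) :
    mapTensor F (f ≫ g) = mapTensor F f ≫ mapTensor F g := by
  simp only [mapTensor, Functor.map_comp, Category.assoc, δ_μ_assoc]

@[simp]
lemma mapTensor_whiskerLeft (S : C) {A B : C} (f : A ⟶ B) :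
    mapTensor F (S ◁ f) = F.obj S ◁ F.map f := by
  rw [mapTensor, ← μ_natural_right_assoc, μ_δ, Category.comp_id]

@[simp]
lemma mapTensor_whiskerRight {S T : C} (f : S ⟶ T) (A : C) :
    mapTensor F (f ▷ A) = F.map f ▷ F.obj A := by
  rw [mapTensor, ← μ_natural_left_assoc, μ_δ, Category.comp_id]

lemma mapTensor_swap (S T A : C) :
    mapTensor F (swap S T A) = F.obj S ◁ δ F T A ≫ swap (F.obj S) (F.obj T) (F.obj A) ≫
      F.obj T ◁ μ F S A := by
  simp only [mapTensor, swap, Functor.map_comp, map_associator, map_associator_inv,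
    map_whiskerRight, Functor.map_braiding, Category.assoc, μ_δ, μ_δ_assoc, comp_whiskerRight,
    whiskerRight_μ_δ_assoc, Category.comp_id]

lemma mapTensor_whiskerLeft_tensor (R : C) {S A T B : C} (f : S ⊗ A ⟶ T ⊗ B) :
    mapTensor F (R ◁ f) = F.obj R ◁ δ F S A ≫ F.obj R ◁ mapTensor F f ≫ F.obj R ◁ μ F T B := by
  rw [mapTensor_whiskerLeft, ← whiskerLeft_comp, ← whiskerLeft_comp, mapTensor]
  simp only [Category.assoc, δ_μ, δ_μ_assoc, Category.comp_id]

lemma mapTensor_thru {S A B : C} (T : C) (f : S ⊗ A ⟶ S ⊗ B) :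
    mapTensor F (thru T f) = F.obj S ◁ δ F T A ≫ thru (F.obj T) (mapTensor F f) ≫
      F.obj S ◁ μ F T B := by
  simp only [thru, mapTensor_comp, mapTensor_swap, mapTensor_whiskerLeft_tensor, Category.assoc,
    whiskerLeft_μ_δ_assoc]

lemma mapTensor_wr {S A B : C} (X : C) (f : S ⊗ A ⟶ S ⊗ B) :
    mapTensor F (wr X f) = F.obj S ◁ δ F A X ≫ wr (F.obj X) (mapTensor F f) ≫
      F.obj S ◁ μ F B X := by
  simp only [mapTensor, wr, Functor.map_comp, map_associator, map_associator_inv,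
    map_whiskerRight, Category.assoc, μ_δ, μ_δ_assoc, comp_whiskerRight, Category.comp_id]

lemma mapTensor_assoc {S T A B : C} (f : S ⊗ (T ⊗ A) ⟶ S ⊗ (T ⊗ B)) :
    mapTensor F ((α_ S T A).hom ≫ f ≫ (α_ S T B).inv) ≫ δ F S T ▷ F.obj B =
      δ F S T ▷ F.obj A ≫ (α_ _ _ _).hom ≫ (F.obj S ◁ μ F T A ≫ mapTensor F f ≫
        F.obj S ◁ δ F T B) ≫ (α_ _ _ _).inv := by
  simp only [mapTensor, Functor.map_comp, map_associator, map_associator_inv, Category.assoc,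
    μ_δ_assoc, whiskerRight_μ_δ, Category.comp_id]

/-- `mapTensor` preserves sequential composition, up to the structure isomorphism on the state
spaces. -/
lemma mapTensor_seqAct {S T A B E : C} (f : S ⊗ A ⟶ S ⊗ B) (g : T ⊗ B ⟶ T ⊗ E) :
    mapTensor F (seqAct f g) ≫ δ F S T ▷ F.obj E =
      δ F S T ▷ F.obj A ≫ seqAct (mapTensor F f) (mapTensor F g) := by
  rw [seqAct_eq, seqAct_eq]
  have := mapTensor_assoc F (thru T f ≫ S ◁ g)
  simp only [Category.assoc] at this
  rw [this, mapTensor_comp, mapTensor_thru, mapTensor_whiskerLeft_tensor]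
  simp

end Transport

end Extension

/-! ### The universal property of stateful processes -/

section FreeExtension

lemma comp_map_id {C : Type u} [Category.{v} C] {D : Type u'} [Category.{v'} D] (G : C ⥤ D)
    {X : C} {Y : D} (f : Y ⟶ G.obj X) : f ≫ G.map (𝟙 X) = f := by
  simp

lemma map_id_comp {C : Type u} [Category.{v} C] {D : Type u'} [Category.{v'} D] (G : C ⥤ D)
    {X : C} {Y : D} (f : G.obj X ⟶ Y) : G.map (𝟙 X) ≫ f = f := by
  simp

open Functor.LaxMonoidal Functor.OplaxMonoidal Functor.Monoidal

variable {C : Type u} [Category.{v} C] [MonoidalCategory C] [SymmetricCategory C]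
  {D : Type u'} [Category.{v'} D] [MonoidalCategory D] [SymmetricCategory D]

namespace St

variable {fbk : FeedbackOperator D} (hfbk : fbk.IsFeedback) (F : C ⥤ D) [F.Braided]

/-- The action of the extension on morphisms: `(S ∣ f)` is sent to the feedback of `f` on `F S`. -/
def extendMap (hfbk : fbk.IsFeedback) (A B : C) :
    ((⟨A⟩ : St C) ⟶ ⟨B⟩) → (F.obj A ⟶ F.obj B) :=
  Quotient.lift (fun x : StatefulMap A B => fbk (F.obj x.state) _ _ (mapTensor F x.act)) (by
    intro x y hxy
    obtain ⟨h, e⟩ := (StatefulMap.rel_iff x y).1 hxy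
    refine hfbk.fbk_eq_of_iso (F.mapIso h) ?_
    simpa only [mapTensor_comp, mapTensor_whiskerRight, Functor.mapIso_hom]
      using congrArg (mapTensor F) e)

lemma extendMap_process {A B S : C} (f : S ⊗ A ⟶ S ⊗ B) :
    extendMap F hfbk A B (process S f) = fbk (F.obj S) _ _ (mapTensor F f) := rfl

lemma extendMap_pureMap {A B : C} (f : A ⟶ B) :
    extendMap F hfbk A B (pureMap f) = F.map f := by
  rw [pureMap, extendMap_process, mapTensor_whiskerLeft]
  -- slide along `ε` to have the unit of `D` as state space
  refine (hfbk.fbk_eq_of_iso (εIso F).symm (whisker_exchange _ _)).trans ?_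
  exact hfbk.fbk_unit _

lemma extendMap_comp {A B E : C} (f : (⟨A⟩ : St C) ⟶ ⟨B⟩) (g : (⟨B⟩ : St C) ⟶ ⟨E⟩) :
    extendMap F hfbk A E (f ≫ g) = extendMap F hfbk A B f ≫ extendMap F hfbk B E g := by
  induction f using hom_ind with | h S f
  induction g using hom_ind with | h T g
  rw [process_comp, extendMap_process, extendMap_process, extendMap_process, ← hfbk.fbk_seqAct]
  exact hfbk.fbk_eq_of_iso (μIso F S T).symm (mapTensor_seqAct F f g)

lemma extendMap_tensor_id {A B : C} (f : (⟨A⟩ : St C) ⟶ ⟨B⟩) (X : C) :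
    extendMap F hfbk A B f ▷ F.obj X ≫ μ F B X =
      μ F A X ≫ extendMap F hfbk (A ⊗ X) (B ⊗ X) (tensor f (𝟙 (⟨X⟩ : St C))) := by
  induction f using hom_ind with | h S f
  rw [tensor_id_right, extendMap_process, extendMap_process, ← hfbk.fbk_wr, hfbk.comp_fbk,
    hfbk.fbk_comp, mapTensor_wr, whiskerLeft_μ_δ_assoc]

lemma extendMap_id_tensor {A B : C} (f : (⟨A⟩ : St C) ⟶ ⟨B⟩) (X : C) :
    F.obj X ◁ extendMap F hfbk A B f ≫ μ F X B =
      μ F X A ≫ extendMap F hfbk (X ⊗ A) (X ⊗ B) (tensor (𝟙 (⟨X⟩ : St C)) f) := by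
  induction f using hom_ind with | h S f
  rw [tensor_id_left, extendMap_process, extendMap_process, ← hfbk.fbk_thru, hfbk.comp_fbk,
    hfbk.fbk_comp, mapTensor_thru, whiskerLeft_μ_δ_assoc]

/-- The extension along the inclusion `C ⥤ St C` of a strong symmetric monoidal functor to a
feedback category. -/
def extendFunctor (hfbk : fbk.IsFeedback) : St C ⥤ D where
  obj A := F.obj A.of
  map f := extendMap F hfbk _ _ f
  map_id A := by
    rw [← pureMap_id]
    exact (extendMap_pureMap hfbk F _).trans (F.map_id _)
  map_comp f g := extendMap_comp hfbk F f g

/-- The structure morphisms of the extension are those of the functor that is extended. -/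
def extendCoreMonoidal : (extendFunctor F hfbk).CoreMonoidal where
  εIso := εIso F
  μIso X Y := μIso F X.of Y.of
  μIso_hom_natural_left f X := extendMap_tensor_id hfbk F f X.of
  μIso_hom_natural_right X f := extendMap_id_tensor hfbk F f X.of
  associativity X Y Z := by
    refine Eq.trans ?_ (associativity F X.of Y.of Z.of)
    exact congrArg (fun t => _ ≫ _ ≫ t) (extendMap_pureMap hfbk F _)
  left_unitality X := by
    refine (Functor.LaxMonoidal.left_unitality F X.of).trans ?_
    exact congrArg (fun t => _ ≫ _ ≫ t) (extendMap_pureMap hfbk F _).symm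
  right_unitality X := by
    refine (Functor.LaxMonoidal.right_unitality F X.of).trans ?_
    exact congrArg (fun t => _ ≫ _ ≫ t) (extendMap_pureMap hfbk F _).symm

instance extendMonoidal : (extendFunctor F hfbk).Monoidal :=
  (extendCoreMonoidal hfbk F).toMonoidal

instance extendBraided : (extendFunctor F hfbk).Braided where
  braided X Y := by
    refine Eq.trans ?_ (Functor.LaxBraided.braided (F := F) X.of Y.of)
    exact congrArg (fun t => _ ≫ t) (extendMap_pureMap hfbk F _)

/-- The extension along `St.inclusion C` of a strong symmetric monoidal functor to a feedback
category, as a strong symmetric monoidal functor. -/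
def extend (hfbk : fbk.IsFeedback) (F : SymmetricMonoidalFunctor C D) :
    SymmetricMonoidalFunctor (St C) D where
  functor := extendFunctor F.functor hfbk

lemma extend_preservesFeedback (F : SymmetricMonoidalFunctor C D) :
    (extend hfbk F).PreservesFeedback store fbk := by
  intro T A B f
  induction f using hom_ind with | h S f
  -- both sides are feedback on `F S`, then on `F T`; joining and sliding along `μ` compare them
  have h := hfbk.tightening (μ F.functor T.of A.of) (mapTensor F.functor f) (δ F.functor T.of B.of)
  refine Eq.trans ?_ (congrArg (fbk _ _ _) h.symm)
  refine Eq.trans ?_ (hfbk.joining _).symm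
  refine hfbk.fbk_eq_of_iso (μIso F.functor S T.of).symm ?_
  exact mapTensor_assoc F.functor f

end St

/-- Strong symmetric monoidal functors that agree on objects are equal when their actions on
morphisms, and the structure morphisms `ε` and `μ`, correspond. -/
lemma SymmetricMonoidalFunctor.ext_of_obj {F G : SymmetricMonoidalFunctor C D}
    (hobj : ∀ X, F.functor.obj X = G.functor.obj X)
    (hmap : ∀ {X Y : C} (f : X ⟶ Y), F.functor.map f ≫ eqToHom (hobj Y) =
      eqToHom (hobj X) ≫ G.functor.map f)
    (hε : ε F.functor ≫ eqToHom (hobj _) = ε G.functor)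
    (hμ : ∀ X Y : C, μ F.functor X Y ≫ eqToHom (hobj _) =
      eqToHom (by rw [hobj, hobj]) ≫ μ G.functor X Y) : F = G := by
  obtain ⟨F, bF⟩ := F
  obtain ⟨G, bG⟩ := G
  obtain rfl : F = G := by
    refine CategoryTheory.Functor.ext hobj fun X Y f => ?_
    have := hmap f
    dsimp at this
    rw [← reassoc_of% this]
    simp
  congr 1
  apply Functor.Braided.toMonoidal_injective
  apply Functor.Monoidal.toLaxMonoidal_injective
  ext
  · simpa using hε
  · simpa using hμ _ _

/-- The extension restricts to the given functor, with the same structure morphisms. -/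
lemma St.inclusion_comp_extend {fbk : FeedbackOperator D} (hfbk : fbk.IsFeedback)
    (F : SymmetricMonoidalFunctor C D) :
    (inclusion C).comp (extend hfbk F) = F := by
  refine SymmetricMonoidalFunctor.ext_of_obj (fun _ => rfl) (fun f => ?_) ?_ (fun X Y => ?_)
  · refine (Category.comp_id _).trans (Eq.trans ?_ (Category.id_comp _).symm)
    exact extendMap_pureMap hfbk _ f
  · refine (Category.comp_id _).trans ?_
    change ε F.functor ≫ (extendFunctor F.functor hfbk).map (𝟙 _) = _
    exact comp_map_id (extendFunctor F.functor hfbk) _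
  · refine (Category.comp_id _).trans (Eq.trans ?_ (Category.id_comp _).symm)
    change μ F.functor X Y ≫ (extendFunctor F.functor hfbk).map (𝟙 _) = _
    exact comp_map_id (extendFunctor F.functor hfbk) _

/-- A feedback functor out of `St C` is determined by its restriction to `C`, since
`(S ∣ f) = store_S (J f)`. -/
lemma St.eq_extend {fbk : FeedbackOperator D} (hfbk : fbk.IsFeedback)
    (G : SymmetricMonoidalFunctor (St C) D) (hG : G.PreservesFeedback store fbk) :
    G = extend hfbk ((inclusion C).comp G) := by
  -- the inclusion is strict, so composing with it leaves the structure morphisms as they are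
  have hε : ε (incl C ⋙ G.functor) = ε G.functor := by
    change ε G.functor ≫ G.functor.map (𝟙 _) = _
    exact comp_map_id G.functor _
  have hμ (X Y : C) : μ (incl C ⋙ G.functor) X Y = μ G.functor ⟨X⟩ ⟨Y⟩ := by
    change μ G.functor ⟨X⟩ ⟨Y⟩ ≫ G.functor.map (𝟙 _) = _
    exact comp_map_id G.functor _
  have hδ (X Y : C) : δ (incl C ⋙ G.functor) X Y = δ G.functor ⟨X⟩ ⟨Y⟩ := by
    change G.functor.map (𝟙 _) ≫ δ G.functor ⟨X⟩ ⟨Y⟩ = _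
    exact map_id_comp G.functor _
  refine SymmetricMonoidalFunctor.ext_of_obj (fun _ => rfl) (fun {A B} f => ?_) ?_ (fun X Y => ?_)
  · refine (Category.comp_id _).trans (Eq.trans ?_ (Category.id_comp _).symm)
    induction f using hom_ind with | h S f
    refine (congrArg G.functor.map (store_pureMap f)).symm.trans ((hG ⟨S⟩ _ _ (pureMap f)).trans ?_)
    refine Eq.trans ?_ (extendMap_process hfbk ((inclusion C).comp G).functor f).symm
    rw [mapTensor]
    refine congrArg (fbk _ _ _) ?_
    refine congr_arg₂ _ (hμ _ _).symm (congr_arg₂ _ rfl (hδ _ _).symm)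
  · exact (Category.comp_id _).trans hε.symm
  · refine (Category.comp_id _).trans (Eq.trans (hμ _ _).symm (Category.id_comp _).symm)

/-- `St C` is the free feedback category over `C` as soon as its isomorphisms come from `C`. -/
theorem St.isFreeFeedbackCategory
    (hC : ∀ {S T : C} (h : (⟨S⟩ : St C) ≅ ⟨T⟩), ∃ k : S ≅ T, h.hom = pureMap k.hom) :
    IsFreeFeedbackCategory.{_, _, _, _, w₁, w₂} (store (C := C)) (inclusion C) := by
  refine ⟨store_isFeedback hC, ?_⟩
  intro E _ _ _ fbkE hfbk F
  refine ⟨extend hfbk F, ⟨extend_preservesFeedback hfbk F, inclusion_comp_extend hfbk F⟩, ?_⟩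
  rintro G ⟨hG, rfl⟩
  exact eq_extend hfbk G hG

end FreeExtension

/-! ### Isomorphisms of cospans and of stateful cospans -/

section CospanIsos

namespace Cospan

variable {C : Type u} [Category.{v} C] [HasPushouts C]

lemma exists_iso_of_cospan_eq {A B X Y : C} {f : A ⟶ X} {g : B ⟶ X} {f' : A ⟶ Y} {g' : B ⟶ Y}
    (h : cospan f g = cospan f' g') : ∃ e : X ≅ Y, f ≫ e.hom = f' ∧ g ≫ e.hom = g' :=
  Quotient.exact h

/-- A cospan that represents an identity has invertible legs. -/
lemma isIso_of_cospan_eq_id {A X : C} {f g : A ⟶ X} (h : cospan f g = 𝟙 (⟨A⟩ : Cospan C)) :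
    IsIso f ∧ IsIso g := by
  obtain ⟨e, hf, hg⟩ := exists_iso_of_cospan_eq (h.trans (id_eq A))
  rw [← Iso.eq_comp_inv] at hf hg
  rw [hf, hg]
  exact ⟨inferInstance, inferInstance⟩

/-- In an adhesive category, pushouts of monomorphisms are monomorphisms, so the legs of a cospan
with an inverse are invertible: every isomorphism of cospans comes from an isomorphism of `C`. -/
lemma exists_eq_liftIso [Adhesive C] {A B : C} (e : (⟨A⟩ : Cospan C) ≅ ⟨B⟩) :
    ∃ k : A ≅ B, e = liftIso k := by
  obtain ⟨f, g, h₁, h₂⟩ := e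
  induction f using hom_ind with | h X l r
  induction g using hom_ind with | h Y l' r'
  have p := IsPushout.of_hasPushout r l'
  have q := IsPushout.of_hasPushout r' l
  have h₁' := h₁
  have h₂' := h₂
  rw [comp_eq p] at h₁'
  rw [comp_eq q] at h₂'
  obtain ⟨i₁, i₂⟩ := isIso_of_cospan_eq_id h₁'
  obtain ⟨i₃, i₄⟩ := isIso_of_cospan_eq_id h₂'
  have : Mono l := mono_of_mono l (pushout.inl r l')
  have : Mono r' := mono_of_mono r' (pushout.inr r l')
  have : Mono l' := mono_of_mono l' (pushout.inl r' l)
  have : Mono r := mono_of_mono r (pushout.inr r' l)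
  have : Mono (pushout.inl r l') := Adhesive.mono_of_isPushout_of_mono_right p
  have : Mono (pushout.inr r' l) := Adhesive.mono_of_isPushout_of_mono_left q
  -- the coprojections are also split epimorphisms, since the legs of both composites are invertible
  have : IsSplitEpi (pushout.inl r l') :=
    ⟨⟨inv (l ≫ pushout.inl r l') ≫ l, by simp⟩⟩
  have : IsSplitEpi (pushout.inr r' l) :=
    ⟨⟨inv (r ≫ pushout.inr r' l) ≫ r, by simp⟩⟩
  have : IsIso (pushout.inl r l') := isIso_of_mono_of_isSplitEpi _
  have : IsIso (pushout.inr r' l) := isIso_of_mono_of_isSplitEpi _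
  have : IsIso l := IsIso.of_isIso_comp_right l (pushout.inl r l')
  have : IsIso r := IsIso.of_isIso_comp_right r (pushout.inr r' l)
  refine ⟨asIso l ≪≫ (asIso r).symm, Iso.ext ?_⟩
  exact cospan_eq (asIso r).symm rfl (by simp)

variable [HasBinaryCoproducts C] [HasInitial C]

/-- Only initial objects have a tensor inverse in the category of cospans. -/
lemma nonempty_iso_unit [Adhesive C] [HasStrictInitialObjects C] {S T : Cospan C}
    (e : S ⊗ T ≅ 𝟙_ (Cospan C)) : Nonempty (S ≅ 𝟙_ (Cospan C)) := by
  obtain ⟨k, -⟩ := exists_eq_liftIso e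
  have : IsIso (coprod.inl ≫ k.hom) := initialIsInitial.isIso_to _
  exact ⟨liftIso (asIso (coprod.inl ≫ k.hom))⟩

end Cospan

/-- The state space of an isomorphism of stateful processes has a tensor inverse. -/
lemma St.exists_tensor_inverse {C : Type u} [Category.{v} C] [MonoidalCategory C]
    [SymmetricCategory C] {A B S : C} {f : S ⊗ A ⟶ S ⊗ B} (h : IsIso (process S f)) :
    ∃ T : C, Nonempty (S ⊗ T ≅ 𝟙_ C) := by
  obtain ⟨g, h, -⟩ := h
  induction g using hom_ind with | h T g
  obtain ⟨k, -⟩ := Quotient.exact h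
  exact ⟨T, ⟨k⟩⟩

/-- When only the unit has a tensor inverse, an invertible process has trivial state space, so it
is stateless, and the inclusion of `C` reflects its invertibility. -/
lemma St.exists_iso_of_iso {C : Type u} [Category.{v} C] [MonoidalCategory C]
    [SymmetricCategory C] (hC : ∀ {S T : C}, (S ⊗ T ≅ 𝟙_ C) → Nonempty (S ≅ 𝟙_ C))
    {A B : C} (h : (⟨A⟩ : St C) ≅ ⟨B⟩) : ∃ k : A ≅ B, h.hom = pureMap k.hom := by
  have H {A B : C} (f : (⟨A⟩ : St C) ⟶ ⟨B⟩) (hf : IsIso f) : ∃ k : A ⟶ B, f = pureMap k := by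
    induction f using hom_ind with | h S f
    obtain ⟨T, ⟨e⟩⟩ := exists_tensor_inverse hf
    obtain ⟨k⟩ := hC e
    refine ⟨(λ_ A).inv ≫ k.inv ▷ A ≫ f ≫ k.hom ▷ B ≫ (λ_ B).hom, process_eq k ?_⟩
    simp
  obtain ⟨f, hf⟩ := H h.hom inferInstance
  obtain ⟨g, hg⟩ := H h.inv inferInstance
  refine ⟨⟨f, g, pureMap_injective ?_, pureMap_injective ?_⟩, hf⟩
  · rw [pureMap_comp, ← hf, ← hg, h.hom_inv_id, pureMap_id]
  · rw [pureMap_comp, ← hf, ← hg, h.inv_hom_id, pureMap_id]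

end CospanIsos

/-! ### Sequential composition of stateful cospans -/

section StatefulCospans

attribute [local simp] coprod.inl_desc coprod.inr_desc coprod.inl_desc_assoc coprod.inr_desc_assoc

section Coproducts

variable {C : Type u} [Category.{v} C] [HasBinaryCoproducts C]

/-- The exchange of the first two summands of an iterated coproduct. -/
@[simps]
noncomputable def coprodSwap (S T A : C) : S ⨿ (T ⨿ A) ≅ T ⨿ (S ⨿ A) where
  hom := coprod.desc (coprod.inl ≫ coprod.inr) (coprod.desc coprod.inl (coprod.inr ≫ coprod.inr))
  inv := coprod.desc (coprod.inl ≫ coprod.inr) (coprod.desc coprod.inl (coprod.inr ≫ coprod.inr))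
  hom_inv_id := by ext <;> simp
  inv_hom_id := by ext <;> simp

/-- A pushout of `r` and `l'` along a summand `B` of their domains yields a pushout in which the
other summands `S` and `T` are kept. -/
lemma isPushout_coprodSwap {S T B V V' P : C} {r : S ⨿ B ⟶ V} {l' : T ⨿ B ⟶ V'} {i : V ⟶ P}
    {j : V' ⟶ P} (h : IsPushout (coprod.inr ≫ r) (coprod.inr ≫ l') i j) :
    IsPushout ((coprodSwap S T B).hom ≫ coprod.map (𝟙 T) r) (coprod.map (𝟙 S) l')
      (coprod.desc (coprod.inl ≫ l' ≫ j) i) (coprod.desc (coprod.inl ≫ r ≫ i) j) := by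
  have w := h.w
  simp only [Category.assoc] at w
  refine ⟨⟨?_⟩, ⟨PushoutCocone.IsColimit.mk _ (fun s => h.desc (coprod.inr ≫ s.inl)
    (coprod.inr ≫ s.inr) ?_) ?_ ?_ ?_⟩⟩
  · ext <;> simp [w]
  · have := coprod.inr ≫= coprod.inr ≫= s.condition
    simpa using this
  · intro s
    have := coprod.inl ≫= coprod.inr ≫= s.condition
    ext
    · simpa using this.symm
    · simp
  · intro s
    have : (coprod.inl : S ⟶ S ⨿ (T ⨿ B)) ≫ _ = coprod.inl ≫ _ := coprod.inl ≫= s.condition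
    ext
    · simpa using this
    · simp
  · intro s m h₁ h₂
    apply h.hom_ext
    · simp [← h₁]
    · simp [← h₂]

end Coproducts

namespace Cospan

variable {C : Type u} [Category.{v} C] [HasPushouts C] [HasBinaryCoproducts C] [HasInitial C]

lemma swap_eq_lift (S T A : C) :
    swap (⟨S⟩ : Cospan C) ⟨T⟩ ⟨A⟩ = lift (coprodSwap S T A).hom := by
  change lift _ ≫ tensor (lift _) (𝟙 _) ≫ lift _ = _
  rw [tensor_lift_id, ← lift_comp, ← lift_comp]
  congr 1
  ext <;> simp

/-- The cospan obtained by running a stateful cospan in parallel with the identity of `T`. -/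
lemma thru_cospan {S T A B V : C} (l : S ⨿ A ⟶ V) (r : S ⨿ B ⟶ V) :
    thru (⟨T⟩ : Cospan C) (S := ⟨S⟩) (A := ⟨A⟩) (B := ⟨B⟩) (cospan l r) =
      cospan ((coprodSwap S T A).hom ≫ coprod.map (𝟙 T) l)
        ((coprodSwap S T B).hom ≫ coprod.map (𝟙 T) r) := by
  rw [thru, swap_eq_lift, swap_eq_lift]
  change lift _ ≫ cospan (coprod.map (𝟙 T) l) (coprod.map (𝟙 T) r) ≫ lift _ = _
  rw [cospan_comp_lift_iso, lift_comp_cospan]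
  rfl

/-- Sequential composition of stateful cospans glues them along the interface, and keeps both
state spaces. -/
lemma seqAct_cospan {S T A B D V V' P : C} (l : S ⨿ A ⟶ V) (r : S ⨿ B ⟶ V) (l' : T ⨿ B ⟶ V')
    (r' : T ⨿ D ⟶ V') {i : V ⟶ P} {j : V' ⟶ P}
    (h : IsPushout (coprod.inr ≫ r) (coprod.inr ≫ l') i j) :
    seqAct (S := (⟨S⟩ : Cospan C)) (T := ⟨T⟩) (A := ⟨A⟩) (B := ⟨B⟩) (D := ⟨D⟩) (cospan l r)
        (cospan l' r') =
      cospan (C := C)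
        (coprod.desc (coprod.desc (coprod.inl ≫ l ≫ i) (coprod.inl ≫ l' ≫ j)) (coprod.inr ≫ l ≫ i))
        (coprod.desc (coprod.desc (coprod.inl ≫ r ≫ i) (coprod.inl ≫ r' ≫ j))
          (coprod.inr ≫ r' ≫ j)) := by
  rw [seqAct_eq, thru_cospan]
  change lift (coprod.associator S T A).hom ≫ cospan _ _ ≫
    cospan (coprod.map (𝟙 S) l') (coprod.map (𝟙 S) r') ≫ lift (coprod.associator S T D).symm.hom = _
  rw [cospan_comp_lift_iso, comp_eq (isPushout_coprodSwap h), lift_comp_cospan]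
  congr 1
  · ext <;> simp
  · ext <;> simp

end Cospan
end StatefulCospans

/-! ### Marked graphs -/

section MarkedGraphs

open WalkingParallelPair

/-- A morphism out of a discrete graph is determined by its effect on the vertices. -/
lemma discreteGraph_hom_ext {X : Type u} {G : Grph.{u}} {f g : discreteGraph X ⟶ G}
    (h : f.app one = g.app one) : f = g := by
  ext j x
  cases j
  · exact (x : PEmpty).elim
  · exact ConcreteCategory.congr_hom h x

lemma mark_comp {X : Type u} {G G' : Grph.{u}} (l : X ⟶ G.obj one) (φ : G ⟶ G') :
    mark G l ≫ φ = mark G' (l ≫ φ.app one) :=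
  discreteGraph_hom_ext rfl

lemma eq_mark {X : Type u} {G : Grph.{u}} (f : discreteGraph X ⟶ G) : f = mark G (f.app one) :=
  discreteGraph_hom_ext rfl

lemma markedGraph_eq_iff {X Y : Type u} {G G' : Grph.{u}} {l : X ⟶ G.obj one} {r : Y ⟶ G.obj one}
    {l' : X ⟶ G'.obj one} {r' : Y ⟶ G'.obj one} :
    markedGraph G l r = markedGraph G' l' r' ↔
      ∃ φ : G ≅ G', l ≫ φ.hom.app one = l' ∧ r ≫ φ.hom.app one = r' := by
  constructor
  · intro h
    obtain ⟨φ, h₁, h₂⟩ := Cospan.exists_iso_of_cospan_eq (congrArg (·.hom) h)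
    exact ⟨φ, congrArg (·.app one) h₁, congrArg (·.app one) h₂⟩
  · rintro ⟨φ, rfl, rfl⟩
    refine ObjectProperty.hom_ext _ (Cospan.cospan_eq φ ?_ ?_) <;> exact mark_comp _ _

lemma exists_eq_markedGraph {X Y : Type u} (m : DiscreteCospan.of X ⟶ DiscreteCospan.of Y) :
    ∃ (G : Grph.{u}) (l : X ⟶ G.obj one) (r : Y ⟶ G.obj one), m = markedGraph G l r := by
  obtain ⟨m⟩ := m
  induction m using Cospan.hom_ind with | h G f g
  refine ⟨G, f.app one, g.app one, ObjectProperty.hom_ext _ ?_⟩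
  exact congrArg₂ Cospan.cospan (eq_mark f) (eq_mark g)

lemma markedGraph_id (A : Type u) :
    markedGraph (discreteGraph A) (𝟙 A) (𝟙 A) = 𝟙 (DiscreteCospan.of A) := by
  refine ObjectProperty.hom_ext _ ?_
  exact congrArg₂ Cospan.cospan (discreteGraph_hom_ext rfl) (discreteGraph_hom_ext rfl)

lemma isPushout_fromEmpty (E E' : Type u) :
    IsPushout (fromEmpty E) (fromEmpty E') coprod.inl coprod.inr := by
  rw [Types.isInitialPEmpty.hom_ext (fromEmpty E) (Types.isInitialPEmpty.to E),
    Types.isInitialPEmpty.hom_ext (fromEmpty E') (Types.isInitialPEmpty.to E')]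
  exact IsPushout.of_is_coproduct' (coprodIsCoprod E E') Types.isInitialPEmpty

lemma markedGraph_congr {X Y E V : Type u} {s t s' t' : E ⟶ V} {l l' : X ⟶ V} {r r' : Y ⟶ V}
    (hs : s = s') (ht : t = t') (hl : l = l') (hr : r = r') :
    markedGraph (graph s t) l r = markedGraph (graph s' t') l' r' := by
  subst hs ht hl hr; rfl

/-- Marked graphs are composed by identifying the vertices that `r` and `l'` mark; the edges are
those of both graphs. -/
lemma markedGraph_comp {X Y Z E E' V V' P : Type u} {s t : E ⟶ V} {s' t' : E' ⟶ V'}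
    (l : X ⟶ V) (r : Y ⟶ V) (l' : Y ⟶ V') (r' : Z ⟶ V') {i : V ⟶ P} {j : V' ⟶ P}
    (h : IsPushout r l' i j) :
    markedGraph (graph s t) l r ≫ markedGraph (graph s' t') l' r' =
      markedGraph (graph (coprod.desc (s ≫ i) (s' ≫ j)) (coprod.desc (t ≫ i) (t' ≫ j)))
        (l ≫ i) (r' ≫ j) := by
  let G := graph (coprod.desc (s ≫ i) (s' ≫ j)) (coprod.desc (t ≫ i) (t' ≫ j))
  let p : graph s t ⟶ G := parallelPairHomMk (F := graph s t) (G := G) (coprod.inl : E ⟶ E ⨿ E') i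
    (coprod.inl_desc (s ≫ i) (s' ≫ j)).symm (coprod.inl_desc (t ≫ i) (t' ≫ j)).symm
  let q : graph s' t' ⟶ G := parallelPairHomMk (F := graph s' t') (G := G)
    (coprod.inr : E' ⟶ E ⨿ E') j
    (coprod.inr_desc (s ≫ i) (s' ≫ j)).symm (coprod.inr_desc (t ≫ i) (t' ≫ j)).symm
  -- Pushouts of graphs are computed separately on edges and on vertices.
  have H : IsPushout (mark (graph s t) r) (mark (graph s' t') l') p q := by
    refine IsPushout.of_forall_isPushout_app fun k => ?_
    cases k
    · exact isPushout_fromEmpty E E'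
    · exact h
  refine ObjectProperty.hom_ext _ ((Cospan.comp_eq H).trans ?_)
  exact congrArg₂ Cospan.cospan (mark_comp _ _) (mark_comp _ _)

end MarkedGraphs

/-! ### The comparison of stateful cospans with marked graphs -/

section Comparison

open WalkingParallelPair

/-- The graph of a stateful cospan `E + A ⟶ V ⟵ E + B`, marked by the images of `A` and `B`. The
edges are the elements of the state space `E`; their sources are given by the right leg and their
targets by the left leg. -/
noncomputable def toMarkedGraph {A B E V : Type u} (l : E ⨿ A ⟶ V) (r : E ⨿ B ⟶ V) :
    DiscreteCospan.of A ⟶ DiscreteCospan.of B :=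
  markedGraph (graph (coprod.inl ≫ r) (coprod.inl ≫ l)) (coprod.inr ≫ l) (coprod.inr ≫ r)

lemma toMarkedGraph_eq_iff {A B E V E' V' : Type u} {l : E ⨿ A ⟶ V} {r : E ⨿ B ⟶ V}
    {l' : E' ⨿ A ⟶ V'} {r' : E' ⨿ B ⟶ V'} :
    toMarkedGraph l r = toMarkedGraph l' r' ↔ ∃ (k : E ≅ E') (e : V ≅ V'),
      l ≫ e.hom = coprod.map k.hom (𝟙 A) ≫ l' ∧ r ≫ e.hom = coprod.map k.hom (𝟙 B) ≫ r' := by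
  refine markedGraph_eq_iff.trans ⟨?_, ?_⟩
  · rintro ⟨φ, h₁, h₂⟩
    have h₃ : (coprod.inl ≫ r) ≫ φ.hom.app one = φ.hom.app zero ≫ coprod.inl ≫ r' :=
      φ.hom.naturality WalkingParallelPairHom.left
    have h₄ : (coprod.inl ≫ l) ≫ φ.hom.app one = φ.hom.app zero ≫ coprod.inl ≫ l' :=
      φ.hom.naturality WalkingParallelPairHom.right
    refine ⟨φ.app zero, φ.app one, coprod.hom_ext ?_ ?_, coprod.hom_ext ?_ ?_⟩
    · exact h₄.trans (coprod.inl_map_assoc _ _ _).symm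
    · exact h₁.trans ((coprod.inr_map_assoc _ _ _).trans (Category.id_comp _)).symm
    · exact h₃.trans (coprod.inl_map_assoc _ _ _).symm
    · exact h₂.trans ((coprod.inr_map_assoc _ _ _).trans (Category.id_comp _)).symm
  · rintro ⟨k, e, h₁, h₂⟩
    refine ⟨parallelPairIsoMk (F := graph (coprod.inl ≫ r) (coprod.inl ≫ l))
      (G := graph (coprod.inl ≫ r') (coprod.inl ≫ l')) k e ?_ ?_, ?_, ?_⟩
    · change (coprod.inl ≫ r) ≫ e.hom = k.hom ≫ coprod.inl ≫ r'
      simp [h₂]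
    · change (coprod.inl ≫ l) ≫ e.hom = k.hom ≫ coprod.inl ≫ l'
      simp [h₁]
    · change (coprod.inr ≫ l) ≫ e.hom = coprod.inr ≫ l'
      simp [h₁]
    · change (coprod.inr ≫ r) ≫ e.hom = coprod.inr ≫ r'
      simp [h₂]

/-- Since the isomorphisms of state spaces in `Cospan (Type u)` come from bijections, stateful
cospans are equal exactly when their marked graphs are. -/
lemma statefulCospan_eq_iff {A B E V E' V' : Type u} {l : E ⨿ A ⟶ V} {r : E ⨿ B ⟶ V}
    {l' : E' ⨿ A ⟶ V'} {r' : E' ⨿ B ⟶ V'} :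
    statefulCospan E l r = statefulCospan E' l' r' ↔ ∃ (k : E ≅ E') (e : V ≅ V'),
      l ≫ e.hom = coprod.map k.hom (𝟙 A) ≫ l' ∧ r ≫ e.hom = coprod.map k.hom (𝟙 B) ≫ r' := by
  have H (k : E ≅ E') : Cospan.cospan l r ≫ (Cospan.liftIso k).hom ▷ (⟨B⟩ : Cospan (Type u)) =
      (Cospan.liftIso k).hom ▷ (⟨A⟩ : Cospan (Type u)) ≫ Cospan.cospan l' r' ↔ ∃ e : V ≅ V',
        l ≫ e.hom = coprod.map k.hom (𝟙 A) ≫ l' ∧ r ≫ e.hom = coprod.map k.hom (𝟙 B) ≫ r' := by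
    change Cospan.cospan l r ≫ Cospan.tensor (Cospan.lift k.hom) (𝟙 _) =
      Cospan.tensor (Cospan.lift k.hom) (𝟙 _) ≫ Cospan.cospan l' r' ↔ _
    rw [Cospan.tensor_lift_id, Cospan.tensor_lift_id, Cospan.lift_comp_cospan]
    change Cospan.cospan l r ≫ Cospan.lift (coprod.mapIso k (Iso.refl B)).hom = _ ↔ _
    rw [Cospan.cospan_comp_lift_iso]
    have : ∀ e : V ≅ V', ((coprod.mapIso k (Iso.refl B)).inv ≫ r) ≫ e.hom = r' ↔
        r ≫ e.hom = coprod.map k.hom (𝟙 B) ≫ r' := fun e => by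
      rw [Category.assoc, Iso.inv_comp_eq]; rfl
    constructor
    · intro h
      obtain ⟨e, h₁, h₂⟩ := Cospan.exists_iso_of_cospan_eq h
      exact ⟨e, h₁, (this e).1 h₂⟩
    · rintro ⟨e, h₁, h₂⟩
      exact Cospan.cospan_eq e h₁ ((this e).2 h₂)
  constructor
  · intro h
    obtain ⟨k, hk⟩ := (StatefulMap.rel_iff _ _).1 (Quotient.exact h)
    obtain ⟨k, rfl⟩ := Cospan.exists_eq_liftIso k
    exact ⟨k, (H k).1 hk⟩
  · rintro ⟨k, h⟩
    exact St.process_eq (Cospan.liftIso k) ((H k).2 h)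

lemma statefulCospan_ind {A B : Type u} {p : ((⟨⟨A⟩⟩ : St (Cospan (Type u))) ⟶ ⟨⟨B⟩⟩) → Prop}
    (h : ∀ (E V : Type u) (l : E ⨿ A ⟶ V) (r : E ⨿ B ⟶ V), p (statefulCospan E l r)) (f) :
    p f := by
  induction f using St.hom_ind with | h S f
  obtain ⟨E⟩ := S
  induction f using Cospan.hom_ind with | h V l r
  exact h E V l r

lemma statefulCospan_comp {A B D E E' V V' P : Type u} (l : E ⨿ A ⟶ V) (r : E ⨿ B ⟶ V)
    (l' : E' ⨿ B ⟶ V') (r' : E' ⨿ D ⟶ V') {i : V ⟶ P} {j : V' ⟶ P}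
    (h : IsPushout (coprod.inr ≫ r) (coprod.inr ≫ l') i j) :
    statefulCospan.{u} E l r ≫ statefulCospan.{u} E' l' r' = statefulCospan.{u} (E ⨿ E')
      (coprod.desc (coprod.desc (coprod.inl ≫ l ≫ i) (coprod.inl ≫ l' ≫ j)) (coprod.inr ≫ l ≫ i))
      (coprod.desc (coprod.desc (coprod.inl ≫ r ≫ i) (coprod.inl ≫ r' ≫ j))
        (coprod.inr ≫ r' ≫ j)) :=
  congrArg (St.process _) (Cospan.seqAct_cospan l r l' r' h)

lemma toMarkedGraph_comp {A B D E E' V V' P : Type u} (l : E ⨿ A ⟶ V) (r : E ⨿ B ⟶ V)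
    (l' : E' ⨿ B ⟶ V') (r' : E' ⨿ D ⟶ V') {i : V ⟶ P} {j : V' ⟶ P}
    (h : IsPushout (coprod.inr ≫ r) (coprod.inr ≫ l') i j) :
    toMarkedGraph l r ≫ toMarkedGraph l' r' = toMarkedGraph (E := (E ⨿ E' : Type u)) (V := P)
      (coprod.desc (coprod.desc (coprod.inl ≫ l ≫ i) (coprod.inl ≫ l' ≫ j)) (coprod.inr ≫ l ≫ i))
      (coprod.desc (coprod.desc (coprod.inl ≫ r ≫ i) (coprod.inl ≫ r' ≫ j))
        (coprod.inr ≫ r' ≫ j)) := by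
  refine (markedGraph_comp _ _ _ _ h).trans (markedGraph_congr ?_ ?_ ?_ ?_)
  · simp only [coprod.inl_desc, Category.assoc]
  · simp only [coprod.inl_desc, Category.assoc]
  · exact (Category.assoc _ _ _).trans (coprod.inr_desc _ _).symm
  · exact (Category.assoc _ _ _).trans (coprod.inr_desc _ _).symm

/-- The identity stateful cospan has the empty state space, so its graph has no edges and has the
vertices `⊥ ⨿ A ≅ A`. -/
lemma toMarkedGraph_id (A : Type u) :
    toMarkedGraph (E := ⊥_ (Type u)) (𝟙 (_ ⨿ A)) (𝟙 (_ ⨿ A)) = 𝟙 (DiscreteCospan.of A) := by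
  rw [← markedGraph_id, eq_comm]
  refine markedGraph_eq_iff.2 ⟨parallelPairIsoMk (F := discreteGraph A)
    (G := graph (coprod.inl ≫ 𝟙 ((⊥_ (Type u)) ⨿ A)) (coprod.inl ≫ 𝟙 ((⊥_ (Type u)) ⨿ A)))
    (Types.isInitialPEmpty.uniqueUpToIso initialIsInitial) (coprod.leftUnitor A).symm
    (Types.isInitialPEmpty.hom_ext _ _) (Types.isInitialPEmpty.hom_ext _ _), ?_, ?_⟩
  · exact (Category.id_comp _).trans (Category.comp_id _).symm
  · exact (Category.id_comp _).trans (Category.comp_id _).symm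

/-- The action on morphisms of the comparison functor. It is well defined because equality of
stateful cospans and equality of their marked graphs are the same condition on the cospan
representatives (`statefulCospan_eq_iff`, `toMarkedGraph_eq_iff`). -/
noncomputable def comparisonMap (A B : Type u) :
    ((⟨⟨A⟩⟩ : St (Cospan (Type u))) ⟶ ⟨⟨B⟩⟩) → (DiscreteCospan.of A ⟶ DiscreteCospan.of B) :=
  Quotient.lift (fun x : StatefulMap (⟨A⟩ : Cospan (Type u)) ⟨B⟩ =>
    Quotient.lift (fun c : CospanDiagram (x.state.of ⨿ A) (x.state.of ⨿ B) =>
      toMarkedGraph c.left c.right) (by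
        rintro c c' ⟨e, h₁, h₂⟩
        exact toMarkedGraph_eq_iff.2
          ⟨Iso.refl _, e, by simpa using h₁, by simpa using h₂⟩) x.act) (by
    rintro ⟨⟨E⟩, f⟩ ⟨⟨E'⟩, f'⟩ h
    induction f using Cospan.hom_ind with | h V l r
    induction f' using Cospan.hom_ind with | h V' l' r'
    exact toMarkedGraph_eq_iff.2 (statefulCospan_eq_iff.1 (Quotient.sound h)))

/-- The comparison functor, which sends a stateful cospan to its marked graph. -/
noncomputable def comparison : St (Cospan (Type u)) ⥤ DiscreteCospan.{u} where
  obj A := DiscreteCospan.of A.of.of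
  map f := comparisonMap _ _ f
  map_id A := toMarkedGraph_id A.of.of
  map_comp f g := by
    induction f using statefulCospan_ind with | h E V l r
    induction g using statefulCospan_ind with | h E' V' l' r'
    have h := IsPushout.of_hasPushout (coprod.inr ≫ r) (coprod.inr ≫ l')
    rw [statefulCospan_comp l r l' r' h]
    exact (toMarkedGraph_comp l r l' r' h).symm

instance : comparison.{u}.Faithful where
  map_injective {A B} f g h := by
    induction f using statefulCospan_ind with | h E V l r
    induction g using statefulCospan_ind with | h E' V' l' r'
    exact statefulCospan_eq_iff.2 (toMarkedGraph_eq_iff.1 h)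

instance : comparison.{u}.Full where
  map_surjective {A B} m := by
    obtain ⟨G, l, r, rfl⟩ := exists_eq_markedGraph m
    refine ⟨statefulCospan (G.obj zero) (coprod.desc (G.map .right) l)
      (coprod.desc (G.map .left) r), ?_⟩
    refine markedGraph_eq_iff.2 ⟨parallelPairIsoMk
      (F := graph (coprod.inl ≫ coprod.desc (G.map .left) r)
        (coprod.inl ≫ coprod.desc (G.map .right) l)) (Iso.refl _) (Iso.refl _) ?_ ?_, ?_, ?_⟩
    · exact (Category.comp_id _).trans ((coprod.inl_desc _ _).trans (Category.id_comp _).symm)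
    · exact (Category.comp_id _).trans ((coprod.inl_desc _ _).trans (Category.id_comp _).symm)
    · exact (Category.comp_id _).trans (coprod.inr_desc _ _)
    · exact (Category.comp_id _).trans (coprod.inr_desc _ _)

end Comparison

/-- A fully faithful functor that is bijective on objects is an isomorphism of categories. -/
lemma exists_inverse_of_fullyFaithful {C : Type u} [Category.{v} C] {D : Type u'} [Category.{v'} D]
    (K : C ⥤ D) [K.Full] [K.Faithful] (o : D → C) (h₁ : ∀ X, K.obj (o X) = X)
    (h₂ : ∀ X, o (K.obj X) = X) : ∃ L : D ⥤ C, K ⋙ L = 𝟭 C ∧ L ⋙ K = 𝟭 D := by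
  let L : D ⥤ C :=
    { obj := o
      map := fun f => K.preimage (eqToHom (h₁ _) ≫ f ≫ eqToHom (h₁ _).symm)
      map_id := fun X => K.map_injective (by simp)
      map_comp := fun f g => K.map_injective (by simp) }
  refine ⟨L, CategoryTheory.Functor.ext h₂ fun X Y f => K.map_injective ?_,
    CategoryTheory.Functor.ext h₁ fun X Y f => ?_⟩
  · simp [L, eqToHom_map]
  · simp [L]

end FreeFeedback

theorem mainTheorem3 :
    IsFreeFeedbackCategory.{u + 1, u + 1, u + 1, u + 1, w₁, w₂} (St.store (C := Cospan (Type u)))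
        (St.inclusion (Cospan (Type u))) ∧
      (∃ (K : St (Cospan (Type u)) ⥤ DiscreteCospan.{u})
          (L : DiscreteCospan.{u} ⥤ St (Cospan (Type u))),
        K ⋙ L = 𝟭 _ ∧ L ⋙ K = 𝟭 _ ∧
          ∃ hK : ∀ A : Type u, K.obj ⟨⟨A⟩⟩ = DiscreteCospan.of A,
            ∀ (A B E V : Type u) (l : E ⨿ A ⟶ V) (r : E ⨿ B ⟶ V),
              K.map (statefulCospan E l r) = eqToHom (hK A) ≫
                markedGraph (graph (coprod.inl ≫ r) (coprod.inl ≫ l)) (coprod.inr ≫ l)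
                  (coprod.inr ≫ r) ≫ eqToHom (hK B).symm) ∧
      (∀ (X Y : Type u),
        (∀ m : DiscreteCospan.of X ⟶ DiscreteCospan.of Y,
          ∃ (G : Grph.{u}) (l : X ⟶ G.obj .one) (r : Y ⟶ G.obj .one), m = markedGraph G l r) ∧
        ∀ (G G' : Grph.{u}) (l : X ⟶ G.obj .one) (r : Y ⟶ G.obj .one) (l' : X ⟶ G'.obj .one)
          (r' : Y ⟶ G'.obj .one), markedGraph G l r = markedGraph G' l' r' ↔
            ∃ φ : G ≅ G', l ≫ φ.hom.app .one = l' ∧ r ≫ φ.hom.app .one = r') := by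
  refine ⟨St.isFreeFeedbackCategory (St.exists_iso_of_iso Cospan.nonempty_iso_unit), ?_,
    fun X Y => ⟨exists_eq_markedGraph, fun _ _ _ _ _ _ => markedGraph_eq_iff⟩⟩
  obtain ⟨L, hKL, hLK⟩ := exists_inverse_of_fullyFaithful comparison.{u}
    (fun D => ⟨⟨D.obj.of.obj .one⟩⟩) (by rintro ⟨_, V, rfl⟩; rfl) (fun _ => rfl)
  refine ⟨comparison, L, hKL, hLK, fun _ => rfl, fun A B E V l r => ?_⟩
  exact ((Category.id_comp _).trans (Category.comp_id _)).symm
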